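/- Let $n\ge 1$, $1<q<p<\infty$ and $1<r<\infty$, and let $\omega$ be a non-negative locally integrable function on $\mathbb R^n$. Write $\omega(E)=\int_E\omega(x)\,dx$. "Cube" means a non-degenerate cube with sides parallel to the coordinate axes. For measurable $f$ let $$M(f)(x)=\sup_{Q\ni x}\frac1{|Q|}\int_Q|f(y)|\,dy\in[0,\infty],$$ the supremum being over all cubes $Q$ containing $x$, and for a sequence $\vec f=\{f_k\}$ of measurable functions let $M(\vec f)=\{M(f_k)\}$ and $|\vec f(x)|_r=\big(\sum_{k}|f_k(x)|^r\big)^{1/r}$. We write $\omega\in A_p$ if $$\sup_{Q}\Big(\frac1{|Q|}\int_Q\omega\Big)\Big(\frac1{|Q|}\int_Q\omega^{-\frac1{p-1}}\Big)^{p-1}<\infty .$$ Let $L^p_\omega$ be the space of measurable $f$ with $\|f\|_{L^p_\omega}=\big(\int|f|^p\omega\big)^{1/p}<\infty$, and let $L^{p,\infty}_\omega$ be the space of measurable $f$ with $\|f\|_{L^{p,\infty}_\omega}=\sup_{t>0}t^{1/p}f^*(t)<\infty$, where $f^*(t)=\inf\{s>0:\omega(\{|f|>s\})\le t\}$. Let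 $M^p_{q,\omega}$ and $WM^p_{q,\omega}$ be the spaces of those measurable $f$ with $\int_K|f|^q\omega<\infty$ for every compact $K$ for which, respectively, $$\|f\|_{M^p_{q,\omega}}=\sup_Q\Big(\frac1{\omega(Q)^{1-q/p}}\int_Q|f|^q\omega\Big)^{1/q}<\infty,$$ $$\|f\|_{WM^p_{q,\omega}}=\sup_Q\frac1{\omega(Q)^{\frac1q-\frac1p}}\,\sup_{\lambda>0}\lambda\,\omega(\{x\in Q:|f(x)|>\lambda\})^{1/q}<\infty .$$ (The usual conventions $0^{-a}=\infty$ for $a>0$ and $0\cdot\infty=0$ are in force where $\omega$ or $\omega(Q)$ vanishes.) For each of these spaces $X$, the space $X(\ell^r)$ consists of the sequences $\vec f$ of measurable functions with $|\vec f|_r\in X$, with $\|\vec f\|_{X(\ell^r)}=\||\vec f|_r\|_X$. The operator $M$ is bounded from $X(\ell^r)$ to $Y(\ell^r)$ if there is a constant $C<\infty$ such that $M(\vec f)\in Y(\ell^r)$ and $\|M(\vec f)\|_{Y(\ell^r)}\le C\|\vec f\|_{X(\ell^r)}$ for all $\vec f\in X(\ell^r)$. Then the following statements are equivalent: 1. $\omega\in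 A_p$; 2. $M$ is bounded from $L^p_\omega(\ell^r)$ to $L^{p,\infty}_\omega(\ell^r)$; 3. $M$ is bounded from $L^p_\omega(\ell^r)$ to $M^p_{q,\omega}(\ell^r)$; 4. $M$ is bounded from $L^p_\omega(\ell^r)$ to $WM^p_{q,\omega}(\ell^r)$. -/

import Mathlib

open MeasureTheory
open scoped ENNReal NNReal

noncomputable section

namespace WeightedMaximal

/-- The open cube in `ℝⁿ` with sides parallel to the axes, centre `c` and side length `2 * h`.
(A genuine cube when `0 < h`.) -/
def cube {n : ℕ} (c : Fin n → ℝ) (h : ℝ) : Set (Fin n → ℝ) :=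
  {y | ∀ i, |y i - c i| < h}

/-- Cubes are the balls of the sup norm, which is the norm of `Fin n → ℝ`. -/
theorem cube_eq_ball {n : ℕ} (c : Fin n → ℝ) {h : ℝ} (hh : 0 < h) :
    cube c h = Metric.ball c h := by
  ext y
  simp [cube, dist_pi_lt_iff hh, Real.dist_eq]

/-- The measure `ω(x) dx`; so `weightMeasure ω E` is `ω(E) = ∫_E ω(x) dx`. -/
def weightMeasure {n : ℕ} (ω : (Fin n → ℝ) → ℝ) : Measure (Fin n → ℝ) :=
  volume.withDensity (fun x => ENNReal.ofReal (ω x))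

/-- The uncentred Hardy-Littlewood maximal function: the supremum over all cubes containing `x`
of the averages of `|f|`. It takes the value `∞` where these averages are unbounded. -/
def maximal {n : ℕ} (f : (Fin n → ℝ) → ℂ) (x : Fin n → ℝ) : ℝ≥0∞ :=
  ⨆ (c : Fin n → ℝ) (h : ℝ) (_ : 0 < h) (_ : x ∈ cube c h),
    (volume (cube c h))⁻¹ * ∫⁻ y in cube c h, ‖f y‖ₑ

/-- The Muckenhoupt class `A_p`. The negative power is taken in `[0, ∞]`, so it is `∞` at the
zeros of `ω`. -/
def MuckenhouptA {n : ℕ} (p : ℝ) (ω : (Fin n → ℝ) → ℝ) : Prop :=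
  ∃ C : ℝ≥0, ∀ (c : Fin n → ℝ) (h : ℝ), 0 < h →
    ((volume (cube c h))⁻¹ * ∫⁻ x in cube c h, ENNReal.ofReal (ω x)) *
      ((volume (cube c h))⁻¹ *
        ∫⁻ x in cube c h, ENNReal.ofReal (ω x) ^ (-(1 / (p - 1)))) ^ (p - 1) ≤ C

/-! The norms below depend only on the modulus of a function, and are therefore defined for
functions with values in `[0, ∞]`. -/

/-- The norm of `L^p_ω`. -/
def lebesgueNorm {n : ℕ} (ω : (Fin n → ℝ) → ℝ) (p : ℝ) (F : (Fin n → ℝ) → ℝ≥0∞) : ℝ≥0∞ :=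
  (∫⁻ x, F x ^ p ∂(weightMeasure ω)) ^ (1 / p)

/-- The distribution function `d_F(s) = ω({x : F(x) > s})`. -/
def distribution {n : ℕ} (ω : (Fin n → ℝ) → ℝ) (F : (Fin n → ℝ) → ℝ≥0∞) (s : ℝ≥0∞) : ℝ≥0∞ :=
  weightMeasure ω {x | s < F x}

/-- The decreasing rearrangement `F^*(t) = inf {s > 0 : d_F(s) ≤ t}`, which is `∞` if there is
no such finite `s`. -/
def rearrangement {n : ℕ} (ω : (Fin n → ℝ) → ℝ) (F : (Fin n → ℝ) → ℝ≥0∞) (t : ℝ≥0∞) : ℝ≥0∞ :=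
  sInf {s | 0 < s ∧ distribution ω F s ≤ t}

/-- The quasi-norm of the Lorentz space `L^{p,∞}_ω`: `sup_{t > 0} t^{1/p} F^*(t)`. -/
def weakLebesgueNorm {n : ℕ} (ω : (Fin n → ℝ) → ℝ) (p : ℝ) (F : (Fin n → ℝ) → ℝ≥0∞) : ℝ≥0∞ :=
  ⨆ (t : ℝ) (_ : 0 < t), ENNReal.ofReal t ^ (1 / p) * rearrangement ω F (ENNReal.ofReal t)

/-- The norm of the weighted Morrey space `𝓛^{q,κ}_ω`. -/
def morreyNorm {n : ℕ} (ω : (Fin n → ℝ) → ℝ) (q κ : ℝ) (F : (Fin n → ℝ) → ℝ≥0∞) : ℝ≥0∞ :=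
  ⨆ (c : Fin n → ℝ) (h : ℝ) (_ : 0 < h),
    ((weightMeasure ω (cube c h) ^ κ)⁻¹ *
      ∫⁻ x in cube c h, F x ^ q ∂(weightMeasure ω)) ^ (1 / q)

/-- The quasi-norm of the weighted weak Morrey space `WM^p_{q,ω}`. -/
def weakMorreyNorm {n : ℕ} (ω : (Fin n → ℝ) → ℝ) (p q : ℝ) (F : (Fin n → ℝ) → ℝ≥0∞) : ℝ≥0∞ :=
  ⨆ (c : Fin n → ℝ) (h : ℝ) (_ : 0 < h),
    (weightMeasure ω (cube c h) ^ (1 / q - 1 / p))⁻¹ *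
      ⨆ (l : ℝ) (_ : 0 < l),
        ENNReal.ofReal l *
          weightMeasure ω {x | x ∈ cube c h ∧ ENNReal.ofReal l < F x} ^ (1 / q)

/-- `F ∈ L^q_{ω,loc}`. -/
def LocallyLebesgue {n : ℕ} (ω : (Fin n → ℝ) → ℝ) (q : ℝ) (F : (Fin n → ℝ) → ℝ≥0∞) : Prop :=
  AEMeasurable F volume ∧
    ∀ K : Set (Fin n → ℝ), IsCompact K → ∫⁻ x in K, F x ^ q ∂(weightMeasure ω) < ∞

/-- A space of functions on `ℝⁿ`, described through the moduli of its members: which moduli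
occur, and the (quasi-)norm. -/
structure FunctionSpace (n : ℕ) where
  Mem : ((Fin n → ℝ) → ℝ≥0∞) → Prop
  norm : ((Fin n → ℝ) → ℝ≥0∞) → ℝ≥0∞

/-- `L^p_ω`. -/
def lebesgueSpace {n : ℕ} (ω : (Fin n → ℝ) → ℝ) (p : ℝ) : FunctionSpace n where
  Mem F := AEMeasurable F volume ∧ lebesgueNorm ω p F < ∞
  norm F := lebesgueNorm ω p F

/-- `L^{p,∞}_ω`. -/
def weakLebesgueSpace {n : ℕ} (ω : (Fin n → ℝ) → ℝ) (p : ℝ) : FunctionSpace n where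
  Mem F := AEMeasurable F volume ∧ weakLebesgueNorm ω p F < ∞
  norm F := weakLebesgueNorm ω p F

/-- `M^p_{q,ω} = 𝓛^{q,1-q/p}_ω`. -/
def morreySpace {n : ℕ} (ω : (Fin n → ℝ) → ℝ) (p q : ℝ) : FunctionSpace n where
  Mem F := LocallyLebesgue ω q F ∧ morreyNorm ω q (1 - q / p) F < ∞
  norm F := morreyNorm ω q (1 - q / p) F

/-- `WM^p_{q,ω}`. -/
def weakMorreySpace {n : ℕ} (ω : (Fin n → ℝ) → ℝ) (p q : ℝ) : FunctionSpace n where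
  Mem F := LocallyLebesgue ω q F ∧ weakMorreyNorm ω p q F < ∞
  norm F := weakMorreyNorm ω p q F

/-- `|g(x)|_r = (∑_k g_k(x)^r)^{1/r}` for a sequence of moduli. -/
def seqNorm {n : ℕ} (r : ℝ) (g : ℕ → (Fin n → ℝ) → ℝ≥0∞) (x : Fin n → ℝ) : ℝ≥0∞ :=
  (∑' k, g k x ^ r) ^ (1 / r)

/-- The maximal operator `(f_k) ↦ (M f_k)` is bounded from `X(ℓ^r)` to `Y(ℓ^r)`: it maps
`X(ℓ^r)` into `Y(ℓ^r)`, with a norm inequality. -/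
def MaximalBounded {n : ℕ} (r : ℝ) (X Y : FunctionSpace n) : Prop :=
  ∃ C : ℝ≥0, ∀ f : ℕ → (Fin n → ℝ) → ℂ, (∀ k, AEMeasurable (f k) volume) →
    X.Mem (seqNorm r (fun k x => ‖f k x‖ₑ)) →
      Y.Mem (seqNorm r (fun k => maximal (f k))) ∧
      Y.norm (seqNorm r (fun k => maximal (f k))) ≤
        C * X.norm (seqNorm r (fun k x => ‖f k x‖ₑ))

end WeightedMaximal

end

/-!
The implications between the four statements form a cycle; only the passage from the `A_p` condition
to the vector-valued weak type inequality is deep.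

* `A_p` implies the weak type inequality. Here the strong type inequality, the weighted
  Fefferman-Stein inequality `exists_lintegral_seqNorm_maxFun_le`, is proved. If the exponent `r` of
  the sequence space equals `p`, it is Muckenhoupt's theorem applied to each member of the sequence.
  Extrapolation (`exists_extrapolation`) carries it from the exponent `r`, for all weights in `A_r`,
  to the exponent `p`, for all weights in `A_p`. The `A_r` weights which this needs are products of
  powers of the given weight and of an `A_1` majorant, built by the Rubio de Francia algorithm
  (`exists_muckenhouptOne_majorant`). All constants have to be uniform over the weights with a given
  `A_p` constant.
* Muckenhoupt's theorem (`exists_lintegral_maxFun_rpow_mul_le`) follows without the open-ended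
  property of `A_p`: the maximal function is dominated pointwise by a composition of two maximal
  functions, one with respect to the measure `w dx` and one with respect to the measure given by the
  dual weight (`IsMuckenhoupt.maxFun_rpow_le`). Both measures are doubling, so that the Vitali
  covering lemma and interpolation between `L^1` and `L^∞` bound these two maximal functions on
  `L^p` of their own measure (`exists_lintegral_maxFun_rpow_le`).
* The weak type inequality implies boundedness into the Morrey space by Kolmogorov's inequality on
  each cube (`lintegral_rpow_le_of_measure_lt_le`), and the weak Morrey norm is at most the Morrey
  norm by Chebyshev's inequality.
* Boundedness into the weak Morrey space is tested on `(ω + ε) ^ (-1 / (p - 1))`, restricted to a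
  cube; on that cube the weak Morrey quasi-norm of the maximal function is at least the average
  times `ω(Q) ^ (1 / p)`, and the `A_p` condition follows as `ε → 0`.

A weight in `A_p` may vanish almost everywhere, in which case all norms are zero; otherwise it is
positive almost everywhere (`MuckenhouptA.ae_eq_zero_or_isMuckenhoupt`). The intermediate results
are stated for weights with values in `[0, ∞]` which are positive and finite almost everywhere.
-/

noncomputable section

namespace WeightedMaximal

variable {n : ℕ}

/-! ### Cubes and maximal functions -/

lemma isOpen_cube (c : Fin n → ℝ) (h : ℝ) : IsOpen (cube c h) := by
  have : cube c h = ⋂ i, {y : Fin n → ℝ | |y i - c i| < h} := by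
    ext y; simp [cube]
  rw [this]
  exact isOpen_iInter_of_finite fun i => isOpen_lt (by fun_prop) continuous_const

lemma measurableSet_cube (c : Fin n → ℝ) (h : ℝ) : MeasurableSet (cube c h) :=
  (isOpen_cube c h).measurableSet

lemma volume_cube (c : Fin n → ℝ) {h : ℝ} (hh : 0 < h) :
    volume (cube c h) = ENNReal.ofReal (2 * h) ^ n := by
  rw [cube_eq_ball c hh, Real.volume_pi_ball c hh, Fintype.card_fin,
    ENNReal.ofReal_pow (by positivity)]

lemma volume_cube_ne_zero (c : Fin n → ℝ) {h : ℝ} (hh : 0 < h) : volume (cube c h) ≠ 0 := by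
  rw [volume_cube c hh]
  exact pow_ne_zero _ (by simpa using hh)

lemma volume_cube_ne_top (c : Fin n → ℝ) {h : ℝ} (hh : 0 < h) : volume (cube c h) ≠ ∞ := by
  rw [volume_cube c hh]
  exact ENNReal.pow_ne_top ENNReal.ofReal_ne_top

lemma mem_cube_self (c : Fin n → ℝ) {h : ℝ} (hh : 0 < h) : c ∈ cube c h := by
  simpa [cube] using fun _ => hh

/-- The uncentred maximal function over cubes, with averages taken with respect to `μ`, of a
function with values in `[0, ∞]`. -/
def maxFun (μ : Measure (Fin n → ℝ)) (F : (Fin n → ℝ) → ℝ≥0∞) (x : Fin n → ℝ) : ℝ≥0∞ :=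
  ⨆ (c : Fin n → ℝ) (h : ℝ) (_ : 0 < h) (_ : x ∈ cube c h),
    (μ (cube c h))⁻¹ * ∫⁻ y in cube c h, F y ∂μ

lemma average_le_maxFun (μ : Measure (Fin n → ℝ)) (F : (Fin n → ℝ) → ℝ≥0∞) {c x : Fin n → ℝ}
    {h : ℝ} (hh : 0 < h) (hx : x ∈ cube c h) :
    (μ (cube c h))⁻¹ * ∫⁻ y in cube c h, F y ∂μ ≤ maxFun μ F x :=
  le_iSup_of_le c <| le_iSup_of_le h <| le_iSup_of_le hh <| le_iSup_of_le hx le_rfl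

lemma maxFun_le {μ : Measure (Fin n → ℝ)} {F : (Fin n → ℝ) → ℝ≥0∞} {x : Fin n → ℝ} {a : ℝ≥0∞}
    (H : ∀ c h, 0 < h → x ∈ cube c h → (μ (cube c h))⁻¹ * ∫⁻ y in cube c h, F y ∂μ ≤ a) :
    maxFun μ F x ≤ a :=
  iSup_le fun c => iSup_le fun h => iSup_le fun hh => iSup_le fun hx => H c h hh hx

lemma lt_maxFun_iff {μ : Measure (Fin n → ℝ)} {F : (Fin n → ℝ) → ℝ≥0∞} {x : Fin n → ℝ}
    {a : ℝ≥0∞} :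
    a < maxFun μ F x ↔ ∃ c h, 0 < h ∧ x ∈ cube c h ∧
      a < (μ (cube c h))⁻¹ * ∫⁻ y in cube c h, F y ∂μ := by
  simp only [maxFun, lt_iSup_iff, exists_prop]

lemma isOpen_lt_maxFun (μ : Measure (Fin n → ℝ)) (F : (Fin n → ℝ) → ℝ≥0∞) (a : ℝ≥0∞) :
    IsOpen {x | a < maxFun μ F x} := by
  rw [isOpen_iff_mem_nhds]
  intro x hx
  obtain ⟨c, h, hh, hxc, ha⟩ := lt_maxFun_iff.1 hx
  filter_upwards [(isOpen_cube c h).mem_nhds hxc] with y hy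
  exact lt_maxFun_iff.2 ⟨c, h, hh, hy, ha⟩

lemma measurable_maxFun (μ : Measure (Fin n → ℝ)) (F : (Fin n → ℝ) → ℝ≥0∞) :
    Measurable (maxFun μ F) :=
  measurable_of_Ioi fun a => (isOpen_lt_maxFun μ F a).measurableSet

lemma maxFun_congr_ae {μ : Measure (Fin n → ℝ)} {F G : (Fin n → ℝ) → ℝ≥0∞} (h : F =ᵐ[μ] G) :
    maxFun μ F = maxFun μ G := by
  ext x
  have H (c : Fin n → ℝ) (l : ℝ) : ∫⁻ y in cube c l, F y ∂μ = ∫⁻ y in cube c l, G y ∂μ :=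
    lintegral_congr_ae (ae_restrict_of_ae h)
  simp only [maxFun, H]

/-! ### Doubling measures: the weak type and strong type inequalities -/

/-- `μ` of a cube grows at most by the factor `D` when the cube is dilated four times; the factor
four is what the Vitali covering lemma needs. -/
def DoublingWith (D : ℝ≥0) (μ : Measure (Fin n → ℝ)) : Prop :=
  ∀ (c : Fin n → ℝ) (h : ℝ), 0 < h → μ (cube c (4 * h)) ≤ D * μ (cube c h)

/-- The weak type `(1, 1)` inequality for the maximal function of a doubling measure, from the
Vitali covering lemma. -/
lemma DoublingWith.mul_measure_lt_maxFun_le {D : ℝ≥0} {μ : Measure (Fin n → ℝ)}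
    (hD : DoublingWith D μ) (F : (Fin n → ℝ) → ℝ≥0∞) (a : ℝ≥0∞) :
    a * μ {x | a < maxFun μ F x} ≤ D * ∫⁻ x, F x ∂μ := by
  -- Cubes of bounded size are treated first, as the covering lemma needs bounded radii.
  let t : ℕ → Set ((Fin n → ℝ) × ℝ) := fun N =>
    {b | 0 < b.2 ∧ b.2 ≤ N ∧ a < (μ (cube b.1 b.2))⁻¹ * ∫⁻ y in cube b.1 b.2, F y ∂μ}
  let S : ℕ → Set (Fin n → ℝ) := fun N => ⋃ b ∈ t N, cube b.1 b.2
  have key : ∀ N, a * μ (S N) ≤ D * ∫⁻ x, F x ∂μ := by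
    intro N
    obtain ⟨u, hut, hdisj, hcov⟩ := Vitali.exists_disjoint_subfamily_covering_enlargement_ball
      (t N) (fun b => b.1) (fun b => b.2) N (fun b hb => hb.2.1) 4 (by norm_num)
    have hball : ∀ b ∈ u, Metric.ball b.1 b.2 = cube b.1 b.2 := fun b hb =>
      (cube_eq_ball _ (hut hb).1).symm
    have hdisj' : u.PairwiseDisjoint fun b => cube b.1 b.2 := by
      intro b hb b' hb' hne
      have := hdisj hb hb' hne
      simpa [Function.onFun, hball b hb, hball b' hb'] using this
    have hcount : u.Countable := hdisj'.countable_of_isOpen (fun b _ => isOpen_cube _ _)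
      (fun b hb => ⟨b.1, mem_cube_self _ (hut hb).1⟩)
    have hSsub : S N ⊆ ⋃ b ∈ u, cube b.1 (4 * b.2) := by
      intro x hx
      obtain ⟨b, hb, hxb⟩ := Set.mem_iUnion₂.1 hx
      obtain ⟨b', hb', hsub⟩ := hcov b hb
      refine Set.mem_iUnion₂.2 ⟨b', hb', ?_⟩
      have h4 : 0 < 4 * b'.2 := by have := (hut hb').1; linarith
      rw [cube_eq_ball _ h4]
      rw [cube_eq_ball _ hb.1] at hxb
      exact hsub hxb
    have : Countable u := hcount.to_subtype
    calc a * μ (S N) ≤ a * ∑' b : u, μ (cube b.1.1 (4 * b.1.2)) := by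
          gcongr
          exact (measure_mono hSsub).trans (measure_biUnion_le μ hcount _)
      _ ≤ a * ∑' b : u, D * μ (cube b.1.1 b.1.2) := by
          gcongr with b
          exact hD _ _ (hut b.2).1
      _ = D * ∑' b : u, a * μ (cube b.1.1 b.1.2) := by
          rw [ENNReal.tsum_mul_left, ENNReal.tsum_mul_left, mul_left_comm]
      _ ≤ D * ∑' b : u, ∫⁻ y in cube b.1.1 b.1.2, F y ∂μ := by
          gcongr with b
          have hb := (hut b.2).2.2
          rw [← ENNReal.div_eq_inv_mul] at hb
          exact ENNReal.mul_le_of_le_div hb.le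
      _ = D * ∫⁻ y in ⋃ b ∈ u, cube b.1 b.2, F y ∂μ := by
          rw [lintegral_biUnion hcount (fun b _ => measurableSet_cube _ _) hdisj']
      _ ≤ D * ∫⁻ x, F x ∂μ := by
          gcongr
          exact Measure.restrict_le_self
  have hmono : Monotone S := by
    intro N M hNM x hx
    obtain ⟨b, hb, hxb⟩ := Set.mem_iUnion₂.1 hx
    exact Set.mem_iUnion₂.2 ⟨b, ⟨hb.1, hb.2.1.trans (by exact_mod_cast hNM), hb.2.2⟩, hxb⟩
  have hunion : {x | a < maxFun μ F x} = ⋃ N, S N := by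
    ext x
    simp only [Set.mem_ofPred_eq, lt_maxFun_iff, Set.mem_iUnion, S, t]
    constructor
    · rintro ⟨c, h, hh, hx, ha⟩
      obtain ⟨N, hN⟩ := exists_nat_ge h
      exact ⟨N, (c, h), ⟨hh, hN, ha⟩, hx⟩
    · rintro ⟨N, b, ⟨hh, -, ha⟩, hx⟩
      exact ⟨b.1, b.2, hh, hx, ha⟩
  rw [hunion, hmono.measure_iUnion, ENNReal.mul_iSup]
  exact iSup_le key

/-- The truncation underlying interpolation between `L^1` and `L^∞`: only the part of `F` above
the height `a` contributes to the set where the maximal function exceeds `2 * a`. -/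
lemma DoublingWith.mul_measure_two_mul_lt_maxFun_le {D : ℝ≥0} {μ : Measure (Fin n → ℝ)}
    (hD : DoublingWith D μ) {F : (Fin n → ℝ) → ℝ≥0∞} (hF : Measurable F) (a : ℝ≥0∞) :
    a * μ {x | 2 * a < maxFun μ F x} ≤ D * ∫⁻ x in {x | a < F x}, F x ∂μ := by
  have hm : MeasurableSet {x | a < F x} := measurableSet_lt measurable_const hF
  set F' := {x | a < F x}.indicator F with hF'
  have hsub : {x | 2 * a < maxFun μ F x} ⊆ {x | a < maxFun μ F' x} := by
    intro x hx
    by_contra hcon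
    simp only [Set.mem_ofPred_eq, not_lt] at hcon hx
    refine hx.not_ge (maxFun_le fun c h hh hxc => ?_)
    calc (μ (cube c h))⁻¹ * ∫⁻ y in cube c h, F y ∂μ
        ≤ (μ (cube c h))⁻¹ * ∫⁻ y in cube c h, (F' y + a) ∂μ := by
          gcongr with y
          by_cases hy : a < F y
          · simp [hF', hy]
          · rw [hF', Set.indicator_of_notMem (s := {x | a < F x}) (by simpa using hy), zero_add]
            exact not_lt.1 hy
      _ = (μ (cube c h))⁻¹ * ∫⁻ y in cube c h, F' y ∂μ + (μ (cube c h))⁻¹ * μ (cube c h) * a := by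
          rw [lintegral_add_right _ measurable_const, mul_add, setLIntegral_const]; ring
      _ ≤ maxFun μ F' x + 1 * a := by
          gcongr
          · exact average_le_maxFun μ F' hh hxc
          · exact ENNReal.inv_mul_le_one _
      _ ≤ 2 * a := by rw [two_mul, one_mul]; gcongr
  calc a * μ {x | 2 * a < maxFun μ F x} ≤ a * μ {x | a < maxFun μ F' x} := by gcongr
    _ ≤ D * ∫⁻ x, F' x ∂μ := hD.mul_measure_lt_maxFun_le F' a
    _ = _ := by rw [hF', lintegral_indicator hm]

lemma lintegral_Ioi_indicator_rpow {s : ℝ} (hs : -1 < s) (a : ℝ≥0∞) :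
    ∫⁻ t in Set.Ioi (0 : ℝ), {t : ℝ | ENNReal.ofReal t < a}.indicator
      (fun t => ENNReal.ofReal (t ^ s)) t = a ^ (s + 1) / ENNReal.ofReal (s + 1) := by
  have hs1 : 0 < s + 1 := by linarith
  have fin : ∀ b : ℝ, 0 ≤ b → ∫⁻ t in Set.Ioi (0 : ℝ),
      {t : ℝ | ENNReal.ofReal t < ENNReal.ofReal b}.indicator
      (fun t => ENNReal.ofReal (t ^ s)) t =
        ENNReal.ofReal b ^ (s + 1) / ENNReal.ofReal (s + 1) := by
    intro b hb
    have hms : MeasurableSet {t : ℝ | ENNReal.ofReal t < ENNReal.ofReal b} :=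
      measurableSet_lt ENNReal.measurable_ofReal measurable_const
    rw [setLIntegral_indicator hms]
    have : {t : ℝ | ENNReal.ofReal t < ENNReal.ofReal b} ∩ Set.Ioi 0 = Set.Ioo 0 b := by
      ext t
      simp only [Set.mem_inter_iff, Set.mem_ofPred_eq, Set.mem_Ioi, Set.mem_Ioo]
      constructor
      · rintro ⟨h1, h2⟩
        exact ⟨h2, (ENNReal.ofReal_lt_ofReal_iff_of_nonneg h2.le).1 h1⟩
      · rintro ⟨h1, h2⟩
        exact ⟨(ENNReal.ofReal_lt_ofReal_iff_of_nonneg h1.le).2 h2, h1⟩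
    rw [this, restrict_Ioo_eq_restrict_Ioc, ← ofReal_integral_eq_lintegral_ofReal,
      ← intervalIntegral.integral_of_le hb, integral_rpow (Or.inl hs),
      Real.zero_rpow hs1.ne', sub_zero, ENNReal.ofReal_div_of_pos hs1,
      ENNReal.ofReal_rpow_of_nonneg hb hs1.le]
    · exact (intervalIntegrable_iff_integrableOn_Ioc_of_le hb).1
        (intervalIntegral.intervalIntegrable_rpow' hs)
    · filter_upwards [ae_restrict_mem measurableSet_Ioc] with t ht
      exact Real.rpow_nonneg ht.1.le s
  induction a with
  | coe a =>
    have := fin a a.2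
    simpa using this
  | top =>
    rw [ENNReal.top_rpow_of_pos hs1, ENNReal.top_div_of_ne_top ENNReal.ofReal_ne_top]
    refine ENNReal.eq_top_of_forall_nnreal_le fun r => ?_
    have h0 : ENNReal.ofReal (s + 1) ≠ 0 := by simpa using hs1
    set b := (((s + 1) * r) ^ (1 / (s + 1)) : ℝ) with hb
    have hb0 : 0 ≤ b := by positivity
    calc (r : ℝ≥0∞) = ENNReal.ofReal b ^ (s + 1) / ENNReal.ofReal (s + 1) := by
          rw [ENNReal.ofReal_rpow_of_nonneg hb0 hs1.le, hb, ← Real.rpow_mul (by positivity),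
            one_div_mul_cancel hs1.ne', Real.rpow_one, ENNReal.ofReal_mul hs1.le, mul_comm,
            ENNReal.mul_div_cancel_right h0 ENNReal.ofReal_ne_top, ENNReal.ofReal_coe_nnreal]
      _ ≤ _ := by
          rw [← fin b hb0]
          refine lintegral_mono fun t => Set.indicator_le_indicator_of_subset ?_ (by simp) t
          intro t _
          simp

/-- The layer cake formula for `[0, ∞]`-valued functions, in the form of a change of the order of
integration over the levels `t` and the points `x`. -/
lemma lintegral_Ioi_rpow_mul_setLIntegral {α : Type*} [MeasurableSpace α] {μ : Measure α}
    [SFinite μ] {s : ℝ} (hs : -1 < s) {G H : α → ℝ≥0∞} (hG : Measurable G) (hH : Measurable H) :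
    ∫⁻ t in Set.Ioi (0 : ℝ), ENNReal.ofReal (t ^ s) *
      ∫⁻ x in {x | ENNReal.ofReal t < G x}, H x ∂μ =
    (ENNReal.ofReal (s + 1))⁻¹ * ∫⁻ x, H x * G x ^ (s + 1) ∂μ := by
  have hset : MeasurableSet {z : ℝ × α | ENNReal.ofReal z.1 < G z.2} :=
    measurableSet_lt (ENNReal.measurable_ofReal.comp measurable_fst) (hG.comp measurable_snd)
  have h1 : ∀ t : ℝ, ENNReal.ofReal (t ^ s) * ∫⁻ x in {x | ENNReal.ofReal t < G x}, H x ∂μ =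
      ∫⁻ x, {z : ℝ × α | ENNReal.ofReal z.1 < G z.2}.indicator
        (fun z => ENNReal.ofReal (z.1 ^ s) * H z.2) (t, x) ∂μ := by
    intro t
    rw [← lintegral_const_mul _ hH,
      ← lintegral_indicator (measurableSet_lt measurable_const hG)]
    rfl
  simp_rw [h1]
  rw [lintegral_lintegral_swap]
  · rw [← lintegral_const_mul (f := fun x => H x * G x ^ (s + 1)) _ (hH.mul (hG.pow_const _))]
    congr 1
    ext x
    have := lintegral_Ioi_indicator_rpow hs (G x)
    calc _ = ∫⁻ t in Set.Ioi (0 : ℝ), {t : ℝ | ENNReal.ofReal t < G x}.indicator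
          (fun t => ENNReal.ofReal (t ^ s)) t * H x := by
          congr 1; ext t
          by_cases ht : ENNReal.ofReal t < G x <;> simp [ht]
      _ = _ := by
          rw [lintegral_mul_const, this, div_eq_mul_inv]
          · ring
          · exact Measurable.indicator (by fun_prop)
              (measurableSet_lt ENNReal.measurable_ofReal measurable_const)
  · refine Measurable.aemeasurable ?_
    refine Measurable.indicator ?_ hset
    exact ((measurable_fst.pow_const s).ennreal_ofReal).mul (hH.comp measurable_snd)

/-- The strong type `(p, p)` inequality for the maximal function of a doubling measure. -/
theorem exists_lintegral_maxFun_rpow_le (n : ℕ) (D : ℝ≥0) {p : ℝ} (hp : 1 < p) :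
    ∃ K : ℝ≥0, ∀ (μ : Measure (Fin n → ℝ)) [SFinite μ], DoublingWith D μ →
      ∀ F : (Fin n → ℝ) → ℝ≥0∞, Measurable F →
        ∫⁻ x, maxFun μ F x ^ p ∂μ ≤ K * ∫⁻ x, F x ^ p ∂μ := by
  have hp0 : 0 < p := by linarith
  have hp1 : 0 < p - 1 := by linarith
  have hne : ENNReal.ofReal (p - 1) ≠ 0 := by simpa using hp1
  set K : ℝ≥0∞ := ENNReal.ofReal p * (2 * D * ((ENNReal.ofReal (p - 1))⁻¹ * 2 ^ (p - 1))) with hK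
  have hKtop : K ≠ ∞ := by
    have := ENNReal.rpow_ne_top_of_nonneg hp1.le (ENNReal.ofNat_ne_top (n := 2))
    have := ENNReal.inv_ne_top.2 hne
    finiteness
  refine ⟨K.toNNReal, fun μ _ hD F hF => ?_⟩
  rw [ENNReal.coe_toNNReal hKtop]
  have hcake := lintegral_Ioi_rpow_mul_setLIntegral (μ := μ) (s := p - 1) (by linarith)
    (measurable_maxFun μ F) (measurable_const (a := (1 : ℝ≥0∞)))
  have hcake' : ∫⁻ x, maxFun μ F x ^ p ∂μ = ENNReal.ofReal p * ∫⁻ t in Set.Ioi (0 : ℝ),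
      ENNReal.ofReal (t ^ (p - 1)) * μ {x | ENNReal.ofReal t < maxFun μ F x} := by
    simp only [sub_add_cancel, one_mul, lintegral_const, Measure.restrict_apply_univ] at hcake
    rw [hcake, ← mul_assoc, ENNReal.mul_inv_cancel (by simpa using hp0) ENNReal.ofReal_ne_top,
      one_mul]
  have hstep : ∀ t ∈ Set.Ioi (0 : ℝ),
      ENNReal.ofReal (t ^ (p - 1)) * μ {x | ENNReal.ofReal t < maxFun μ F x} ≤
      (2 * D) * (ENNReal.ofReal (t ^ (p - 2)) *
        ∫⁻ x in {x | ENNReal.ofReal t < 2 * F x}, F x ∂μ) := by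
    intro t ht
    have ht0 : (0 : ℝ) < t := ht
    have h2 := hD.mul_measure_two_mul_lt_maxFun_le hF (ENNReal.ofReal (t / 2))
    have e1 : 2 * ENNReal.ofReal (t / 2) = ENNReal.ofReal t := by
      rw [← ENNReal.ofReal_ofNat, ← ENNReal.ofReal_mul (by norm_num)]; congr 1; ring
    have e2 : {x | ENNReal.ofReal (t / 2) < F x} = {x | ENNReal.ofReal t < 2 * F x} := by
      ext x
      simp only [Set.mem_ofPred_eq, ← e1]
      exact (ENNReal.mul_lt_mul_iff_right (by norm_num) (by norm_num)).symm
    rw [e1, e2] at h2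
    have e3 : ENNReal.ofReal (t ^ (p - 1)) =
        ENNReal.ofReal (t ^ (p - 2)) * (2 * ENNReal.ofReal (t / 2)) := by
      rw [e1, ← ENNReal.ofReal_mul (by positivity)]
      congr 1
      nth_rewrite 3 [← Real.rpow_one t]
      rw [← Real.rpow_add ht0]; congr 1; ring
    calc _ = 2 * ENNReal.ofReal (t ^ (p - 2)) *
          (ENNReal.ofReal (t / 2) * μ {x | ENNReal.ofReal t < maxFun μ F x}) := by rw [e3]; ring
      _ ≤ 2 * ENNReal.ofReal (t ^ (p - 2)) *
          (D * ∫⁻ x in {x | ENNReal.ofReal t < 2 * F x}, F x ∂μ) := by gcongr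
      _ = _ := by ring
  have hswap := lintegral_Ioi_rpow_mul_setLIntegral (μ := μ) (s := p - 2) (by linarith)
    (hF.const_mul 2) hF
  have e4 : p - 2 + 1 = p - 1 := by ring
  rw [e4] at hswap
  rw [hcake', hK, mul_assoc]
  gcongr
  calc _ ≤ ∫⁻ t in Set.Ioi (0 : ℝ), (2 * D) * (ENNReal.ofReal (t ^ (p - 2)) *
        ∫⁻ x in {x | ENNReal.ofReal t < 2 * F x}, F x ∂μ) :=
        setLIntegral_mono' measurableSet_Ioi hstep
    _ = (2 * D) * ((ENNReal.ofReal (p - 1))⁻¹ * ∫⁻ x, F x * (2 * F x) ^ (p - 1) ∂μ) := by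
        rw [lintegral_const_mul' _ _ (by finiteness), hswap]
    _ = _ := by
        rw [mul_assoc (2 * (D : ℝ≥0∞)), mul_assoc _ _ (∫⁻ x, F x ^ p ∂μ),
          ← lintegral_const_mul _ (hF.pow_const p)]
        congr 3
        ext x
        rw [ENNReal.mul_rpow_of_nonneg _ _ hp1.le, mul_left_comm]
        congr 1
        nth_rewrite 1 [← ENNReal.rpow_one (F x)]
        rw [← ENNReal.rpow_add_of_nonneg _ _ zero_le_one hp1.le]
        congr 1; ring

/-! ### Muckenhoupt weights -/

/-- The dual weight `w ^ (-1 / (p - 1))` of the weight `w`. -/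
def dualWeight (p : ℝ) (w : (Fin n → ℝ) → ℝ≥0∞) (x : Fin n → ℝ) : ℝ≥0∞ :=
  w x ^ (-(1 / (p - 1)))

/-- `w` is a weight with values in `(0, ∞)` almost everywhere which satisfies the `A_p` condition
with constant `C`. The condition is multiplied out, so that no averages occur in it. -/
structure IsMuckenhoupt (p : ℝ) (C : ℝ≥0) (w : (Fin n → ℝ) → ℝ≥0∞) : Prop where
  measurable : Measurable w
  ne_zero : ∀ᵐ x, w x ≠ 0
  ne_top : ∀ᵐ x, w x ≠ ∞
  bound : ∀ (c : Fin n → ℝ) (h : ℝ), 0 < h →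
    (∫⁻ x in cube c h, w x) * (∫⁻ x in cube c h, dualWeight p w x) ^ (p - 1) ≤
      C * volume (cube c h) ^ p

lemma lintegral_weight {w F : (Fin n → ℝ) → ℝ≥0∞} (hw : Measurable w) (hF : Measurable F) :
    ∫⁻ x, F x ∂(volume.withDensity w) = ∫⁻ x, F x * w x := by
  rw [lintegral_withDensity_eq_lintegral_mul _ hw hF]
  simp only [Pi.mul_apply, mul_comm]

lemma setLIntegral_weight {w F : (Fin n → ℝ) → ℝ≥0∞} (hw : Measurable w) (hF : Measurable F)
    {s : Set (Fin n → ℝ)} (hs : MeasurableSet s) :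
    ∫⁻ x in s, F x ∂(volume.withDensity w) = ∫⁻ x in s, F x * w x := by
  rw [setLIntegral_withDensity_eq_setLIntegral_mul _ hw hF hs]
  simp only [Pi.mul_apply, mul_comm]

lemma withDensity_cube (w : (Fin n → ℝ) → ℝ≥0∞) (c : Fin n → ℝ) (h : ℝ) :
    volume.withDensity w (cube c h) = ∫⁻ x in cube c h, w x :=
  withDensity_apply _ (measurableSet_cube c h)

namespace IsMuckenhoupt

variable {p : ℝ} {C : ℝ≥0} {w : (Fin n → ℝ) → ℝ≥0∞}

lemma measurable_dualWeight (hw : IsMuckenhoupt p C w) : Measurable (dualWeight p w) :=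
  hw.measurable.pow_const _

lemma dualWeight_dualWeight (hp : 1 < p) (w : (Fin n → ℝ) → ℝ≥0∞) :
    dualWeight (p / (p - 1)) (dualWeight p w) = w := by
  ext x
  have hp1 : p - 1 ≠ 0 := by linarith
  have : p / (p - 1) - 1 = 1 / (p - 1) := by field_simp; ring
  rw [dualWeight, dualWeight, ← ENNReal.rpow_mul, this]
  have : -(1 / (p - 1)) * -(1 / (1 / (p - 1))) = 1 := by field_simp
  rw [this, ENNReal.rpow_one]

/-- The dual weight of an `A_p` weight belongs to `A_{p'}`, where `p' = p / (p - 1)`. -/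
lemma dual (hp : 1 < p) (hw : IsMuckenhoupt p C w) :
    IsMuckenhoupt (p / (p - 1)) (C ^ (1 / (p - 1))) (dualWeight p w) where
  measurable := hw.measurable_dualWeight
  ne_zero := by
    filter_upwards [hw.ne_zero, hw.ne_top] with x h0 h1
    simp [dualWeight, h0, h1]
  ne_top := by
    filter_upwards [hw.ne_zero, hw.ne_top] with x h0 h1
    simp [dualWeight, h0, h1]
  bound c h hh := by
    have hp1 : 0 < p - 1 := by linarith
    have hp2 : 0 ≤ 1 / (p - 1) := by positivity
    rw [dualWeight_dualWeight hp]
    have := ENNReal.rpow_le_rpow (hw.bound c h hh) hp2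
    rw [ENNReal.mul_rpow_of_nonneg _ _ hp2, ENNReal.mul_rpow_of_nonneg _ _ hp2,
      ← ENNReal.rpow_mul, ← ENNReal.rpow_mul, mul_one_div_cancel hp1.ne', ENNReal.rpow_one] at this
    have e : p / (p - 1) - 1 = 1 / (p - 1) := by field_simp; ring
    rw [e, mul_comm, ENNReal.coe_rpow_of_nonneg _ hp2, div_eq_mul_one_div p]
    exact this

lemma setLIntegral_ne_zero (hw : IsMuckenhoupt p C w) (c : Fin n → ℝ) {h : ℝ} (hh : 0 < h) :
    ∫⁻ x in cube c h, w x ≠ 0 := by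
  intro h0
  rw [lintegral_eq_zero_iff hw.measurable] at h0
  have : ∀ᵐ x ∂(volume.restrict (cube c h)), False := by
    filter_upwards [h0, ae_restrict_of_ae hw.ne_zero] with x hx hx'
    exact hx' hx
  rw [ae_iff] at this
  simp [volume_cube_ne_zero c hh] at this

lemma setLIntegral_ne_top (hp : 1 < p) (hw : IsMuckenhoupt p C w) (c : Fin n → ℝ) {h : ℝ}
    (hh : 0 < h) : ∫⁻ x in cube c h, w x ≠ ∞ := by
  intro htop
  have hb := hw.bound c h hh
  have h0 := (hw.dual hp).setLIntegral_ne_zero c hh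
  rw [htop, ENNReal.top_mul] at hb
  · have := ENNReal.rpow_ne_top_of_nonneg (by linarith : (0 : ℝ) ≤ p) (volume_cube_ne_top c hh)
    exact (ENNReal.mul_ne_top ENNReal.coe_ne_top this) (top_le_iff.1 hb)
  · simp only [ne_eq, ENNReal.rpow_eq_zero_iff, not_or, not_and_or, not_lt]
    exact ⟨Or.inl h0, Or.inr (by linarith)⟩

/-- By Hölder, the reverse of the `A_p` inequality holds with constant one. -/
lemma volume_rpow_le (hp : 1 < p) (hw : IsMuckenhoupt p C w) (c : Fin n → ℝ) (h : ℝ) :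
    volume (cube c h) ^ p ≤
      (∫⁻ x in cube c h, w x) * (∫⁻ x in cube c h, dualWeight p w x) ^ (p - 1) := by
  have hp0 : 0 < p := by linarith
  have hp1 : 0 < p - 1 := by linarith
  have H := ENNReal.lintegral_mul_norm_pow_le (μ := volume.restrict (cube c h))
    hw.measurable.aemeasurable hw.measurable_dualWeight.aemeasurable
    (p := 1 / p) (q := (p - 1) / p) (by positivity) (by positivity) (by field_simp; ring)
  have e : ∫⁻ x in cube c h, w x ^ (1 / p) * dualWeight p w x ^ ((p - 1) / p) =
      volume (cube c h) := by
    rw [← setLIntegral_one]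
    refine lintegral_congr_ae (ae_restrict_of_ae ?_)
    filter_upwards [hw.ne_zero, hw.ne_top] with x h0 h1
    rw [dualWeight, ← ENNReal.rpow_mul, ← ENNReal.rpow_add _ _ h0 h1]
    have : 1 / p + -(1 / (p - 1)) * ((p - 1) / p) = 0 := by field_simp; ring
    rw [this, ENNReal.rpow_zero]
  rw [e] at H
  have := ENNReal.rpow_le_rpow H hp0.le
  rwa [ENNReal.mul_rpow_of_nonneg _ _ hp0.le, ← ENNReal.rpow_mul, ← ENNReal.rpow_mul,
    one_div_mul_cancel hp0.ne', ENNReal.rpow_one, div_mul_cancel₀ _ hp0.ne'] at this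

/-- Muckenhoupt weights are doubling. -/
lemma doublingWith (hp : 1 < p) (hw : IsMuckenhoupt p C w) :
    DoublingWith (C * ((4 : ℝ≥0) ^ n) ^ p) (volume.withDensity w) := by
  intro c h hh
  have hp0 : 0 < p := by linarith
  have h4 : 0 < 4 * h := by linarith
  have hsub : cube c h ⊆ cube c (4 * h) := fun y hy i => (hy i).trans (by linarith)
  have hvol : volume (cube c (4 * h)) = (4 : ℝ≥0∞) ^ n * volume (cube c h) := by
    rw [volume_cube c h4, volume_cube c hh, ← mul_pow]
    congr 1
    rw [← ENNReal.ofReal_ofNat, ← ENNReal.ofReal_mul (by norm_num)]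
    congr 1; ring
  have hV0 : volume (cube c h) ^ p ≠ 0 := by
    simp [volume_cube_ne_zero c hh, volume_cube_ne_top c hh]
  have hV1 : volume (cube c h) ^ p ≠ ∞ :=
    ENNReal.rpow_ne_top_of_nonneg hp0.le (volume_cube_ne_top c hh)
  rw [withDensity_cube, withDensity_cube, ← ENNReal.mul_le_mul_iff_left hV0 hV1]
  calc (∫⁻ x in cube c (4 * h), w x) * volume (cube c h) ^ p
      ≤ (∫⁻ x in cube c (4 * h), w x) * ((∫⁻ x in cube c h, w x) *
          (∫⁻ x in cube c (4 * h), dualWeight p w x) ^ (p - 1)) := by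
        gcongr
        refine (hw.volume_rpow_le hp c h).trans ?_
        gcongr
    _ = (∫⁻ x in cube c h, w x) * ((∫⁻ x in cube c (4 * h), w x) *
          (∫⁻ x in cube c (4 * h), dualWeight p w x) ^ (p - 1)) := by ring
    _ ≤ (∫⁻ x in cube c h, w x) * (C * volume (cube c (4 * h)) ^ p) := by
        exact mul_le_mul_right (hw.bound c _ h4) _
    _ = _ := by
        rw [hvol, ENNReal.mul_rpow_of_nonneg _ _ hp0.le]
        push_cast
        rw [ENNReal.coe_rpow_of_nonneg _ hp0.le]
        push_cast
        ring

lemma sigmaFinite (hw : IsMuckenhoupt p C w) : SigmaFinite (volume.withDensity w) :=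
  SigmaFinite.withDensity_of_ne_top hw.ne_top

/-- The pointwise estimate behind Muckenhoupt's theorem: the maximal function is controlled by the
composition of the maximal functions of the two doubling measures given by `w` and by its dual
weight. -/
lemma maxFun_rpow_le (hp : 1 < p) (hw : IsMuckenhoupt p C w) {F : (Fin n → ℝ) → ℝ≥0∞}
    (hF : Measurable F) (x : Fin n → ℝ) :
    maxFun volume F x ^ (p - 1) ≤ C * maxFun (volume.withDensity w) (fun y =>
      maxFun (volume.withDensity (dualWeight p w)) (fun z => F z * (dualWeight p w z)⁻¹) y ^ (p - 1)
        * (w y)⁻¹) x := by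
  have hp1 : 0 < p - 1 := by linarith
  have hσ := hw.dual hp
  set σ := dualWeight p w with hσdef
  set g := maxFun (volume.withDensity σ) (fun z => F z * (σ z)⁻¹) with hg
  have hgm : Measurable g := measurable_maxFun _ _
  have hFσ : Measurable fun z => F z * (σ z)⁻¹ := hF.mul hσ.measurable.inv
  have hgw : Measurable fun y => g y ^ (p - 1) * (w y)⁻¹ :=
    (hgm.pow_const _).mul hw.measurable.inv
  set m := maxFun (volume.withDensity w) (fun y => g y ^ (p - 1) * (w y)⁻¹) x with hm
  have key : maxFun volume F x ≤ (C * m) ^ (p - 1)⁻¹ := by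
    refine maxFun_le fun c h hh hx => ?_
    rw [ENNReal.le_rpow_inv_iff hp1]
    set I := ∫⁻ y in cube c h, F y
    set V := volume (cube c h)
    have hV0 : V ≠ 0 := volume_cube_ne_zero c hh
    have hV1 : V ≠ ∞ := volume_cube_ne_top c hh
    set W := ∫⁻ x in cube c h, w x with hW
    set S := ∫⁻ x in cube c h, σ x with hS
    have hW0 : W ≠ 0 := hw.setLIntegral_ne_zero c hh
    have hW1 : W ≠ ∞ := hw.setLIntegral_ne_top hp c hh
    have hS0 : S ≠ 0 := hσ.setLIntegral_ne_zero c hh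
    have hS1 : S ≠ ∞ := hσ.setLIntegral_ne_top (by rw [one_lt_div hp1]; linarith) c hh
    have hbound : W * S ^ (p - 1) ≤ C * V ^ p := hw.bound c h hh
    have h1 : ∀ y ∈ cube c h, S⁻¹ * I ≤ g y := by
      intro y hy
      have := average_le_maxFun (volume.withDensity σ) (fun z => F z * (σ z)⁻¹) hh hy
      rw [withDensity_cube, setLIntegral_weight hσ.measurable hFσ (measurableSet_cube c h)] at this
      convert this using 2
      refine lintegral_congr_ae (ae_restrict_of_ae ?_)
      filter_upwards [hσ.ne_zero, hσ.ne_top] with z h0 h1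
      rw [mul_assoc, ENNReal.inv_mul_cancel h0 h1, mul_one]
    have h2 : (S⁻¹ * I) ^ (p - 1) * V ≤ W * m := by
      calc (S⁻¹ * I) ^ (p - 1) * V = ∫⁻ y in cube c h, (S⁻¹ * I) ^ (p - 1) := by
            rw [setLIntegral_const]
        _ ≤ ∫⁻ y in cube c h, g y ^ (p - 1) :=
            setLIntegral_mono' (measurableSet_cube c h) fun y hy =>
              ENNReal.rpow_le_rpow (h1 y hy) hp1.le
        _ = ∫⁻ y in cube c h, g y ^ (p - 1) * (w y)⁻¹ ∂(volume.withDensity w) := by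
            rw [setLIntegral_weight hw.measurable hgw (measurableSet_cube c h)]
            refine lintegral_congr_ae (ae_restrict_of_ae ?_)
            filter_upwards [hw.ne_zero, hw.ne_top] with z h0 h1
            rw [mul_assoc, ENNReal.inv_mul_cancel h0 h1, mul_one]
        _ = W * (W⁻¹ * ∫⁻ y in cube c h, g y ^ (p - 1) * (w y)⁻¹ ∂(volume.withDensity w)) := by
            rw [← mul_assoc, ENNReal.mul_inv_cancel hW0 hW1, one_mul]
        _ ≤ W * m := by
            gcongr
            have := average_le_maxFun (volume.withDensity w) (fun y => g y ^ (p - 1) * (w y)⁻¹)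
              hh hx
            rwa [withDensity_cube] at this
    have hVp0 : V ^ p ≠ 0 := by simp [hV0, hV1]
    have hVp1 : V ^ p ≠ ∞ := ENNReal.rpow_ne_top_of_nonneg (by linarith) hV1
    rw [← ENNReal.mul_le_mul_iff_left hVp0 hVp1]
    calc (V⁻¹ * I) ^ (p - 1) * V ^ p = (S⁻¹ * I) ^ (p - 1) * V * S ^ (p - 1) := by
          have eV : V ^ p = V ^ (p - 1) * V := by
            nth_rewrite 3 [← ENNReal.rpow_one V]
            rw [← ENNReal.rpow_add _ _ hV0 hV1, sub_add_cancel]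
          rw [eV, ← mul_assoc, ← ENNReal.mul_rpow_of_nonneg _ _ hp1.le, mul_right_comm _ V,
            ← ENNReal.mul_rpow_of_nonneg _ _ hp1.le, mul_right_comm V⁻¹, mul_right_comm S⁻¹,
            ENNReal.inv_mul_cancel hV0 hV1, ENNReal.inv_mul_cancel hS0 hS1]
      _ ≤ W * m * S ^ (p - 1) := by gcongr
      _ = W * S ^ (p - 1) * m := by ring
      _ ≤ C * V ^ p * m := by gcongr
      _ = C * m * V ^ p := by ring
  rwa [ENNReal.le_rpow_inv_iff hp1] at key

end IsMuckenhoupt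

/-- **Muckenhoupt's theorem**: the maximal function is bounded on `L^p(w)` for `w` in `A_p`, with a
bound depending on `n`, `p` and the constant of `w` only. -/
theorem exists_lintegral_maxFun_rpow_mul_le (n : ℕ) (C : ℝ≥0) {p : ℝ} (hp : 1 < p) :
    ∃ N : ℝ≥0, ∀ w : (Fin n → ℝ) → ℝ≥0∞, IsMuckenhoupt p C w →
      ∀ F : (Fin n → ℝ) → ℝ≥0∞, Measurable F →
        ∫⁻ x, maxFun volume F x ^ p * w x ≤ N * ∫⁻ x, F x ^ p * w x := by
  have hp0 : 0 < p := by linarith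
  have hp1 : 0 < p - 1 := by linarith
  have hp' : 1 < p / (p - 1) := by rw [one_lt_div hp1]; linarith
  have hp'0 : 0 < p / (p - 1) := by linarith
  obtain ⟨K₁, hK₁⟩ := exists_lintegral_maxFun_rpow_le n (C * ((4 : ℝ≥0) ^ n) ^ p) hp'
  obtain ⟨K₂, hK₂⟩ := exists_lintegral_maxFun_rpow_le n
    (C ^ (1 / (p - 1)) * ((4 : ℝ≥0) ^ n) ^ (p / (p - 1))) hp
  refine ⟨C ^ (p / (p - 1)) * K₁ * K₂, fun w hw F hF => ?_⟩
  have hσ := hw.dual hp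
  have := hw.sigmaFinite
  have := hσ.sigmaFinite
  set σ := dualWeight p w with hσdef
  have hFσ : Measurable fun z => F z * (σ z)⁻¹ := hF.mul hσ.measurable.inv
  set g := maxFun (volume.withDensity σ) (fun z => F z * (σ z)⁻¹) with hg
  have hgm : Measurable g := measurable_maxFun _ _
  have hgw : Measurable fun y => g y ^ (p - 1) * (w y)⁻¹ :=
    (hgm.pow_const _).mul hw.measurable.inv
  set m := maxFun (volume.withDensity w) (fun y => g y ^ (p - 1) * (w y)⁻¹) with hm
  have hmm : Measurable m := measurable_maxFun _ _
  calc ∫⁻ x, maxFun volume F x ^ p * w x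
      ≤ ∫⁻ x, (C ^ (p / (p - 1)) : ℝ≥0) * (m x ^ (p / (p - 1)) * w x) := by
        refine lintegral_mono fun x => ?_
        have h1 := ENNReal.rpow_le_rpow (hw.maxFun_rpow_le hp hF x) hp'0.le
        rw [← ENNReal.rpow_mul, mul_div_cancel₀ _ hp1.ne',
          ENNReal.mul_rpow_of_nonneg _ _ hp'0.le] at h1
        rw [ENNReal.coe_rpow_of_nonneg _ hp'0.le, ← mul_assoc]
        gcongr
    _ = (C ^ (p / (p - 1)) : ℝ≥0) * ∫⁻ x, m x ^ (p / (p - 1)) ∂(volume.withDensity w) := by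
        rw [lintegral_const_mul' _ _ ENNReal.coe_ne_top,
          lintegral_weight hw.measurable (hmm.pow_const _)]
    _ ≤ (C ^ (p / (p - 1)) : ℝ≥0) *
          (K₁ * ∫⁻ y, (g y ^ (p - 1) * (w y)⁻¹) ^ (p / (p - 1)) ∂(volume.withDensity w)) := by
        gcongr
        exact hK₁ _ (hw.doublingWith hp) _ hgw
    _ = (C ^ (p / (p - 1)) : ℝ≥0) * (K₁ * ∫⁻ y, g y ^ p ∂(volume.withDensity σ)) := by
        rw [lintegral_weight hw.measurable (hgw.pow_const _),
          lintegral_weight hσ.measurable (hgm.pow_const _)]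
        congr 2
        refine lintegral_congr_ae ?_
        filter_upwards [hw.ne_zero, hw.ne_top] with y h0 h1
        rw [ENNReal.mul_rpow_of_nonneg _ _ hp'0.le, ← ENNReal.rpow_mul,
          mul_div_cancel₀ _ hp1.ne', mul_assoc, hσdef, dualWeight, ← ENNReal.rpow_neg_one,
          ← ENNReal.rpow_mul]
        congr 1
        nth_rewrite 2 [← ENNReal.rpow_one (w y)]
        rw [← ENNReal.rpow_add _ _ h0 h1]
        congr 1
        field_simp
        ring
    _ ≤ (C ^ (p / (p - 1)) : ℝ≥0) *
          (K₁ * (K₂ * ∫⁻ z, (F z * (σ z)⁻¹) ^ p ∂(volume.withDensity σ))) := by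
        gcongr
        exact hK₂ _ (hσ.doublingWith hp') _ hFσ
    _ = (C ^ (p / (p - 1)) : ℝ≥0) * (K₁ * (K₂ * ∫⁻ x, F x ^ p * w x)) := by
        rw [lintegral_weight hσ.measurable (hFσ.pow_const _)]
        congr 3
        refine lintegral_congr_ae ?_
        filter_upwards [hw.ne_zero, hw.ne_top] with y h0 h1
        rw [ENNReal.mul_rpow_of_nonneg _ _ hp0.le, mul_assoc, hσdef, dualWeight,
          ← ENNReal.rpow_neg_one, ← ENNReal.rpow_mul, ← ENNReal.rpow_mul,
          ← ENNReal.rpow_add _ _ h0 h1]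
        congr 1
        nth_rewrite 2 [← ENNReal.rpow_one (w y)]
        congr 1
        field_simp
        ring
    _ = _ := by push_cast; ring

/-! ### The Rubio de Francia algorithm -/

/-- The pointwise `A_1` condition with constant `K`. -/
structure IsMuckenhouptOne (K : ℝ≥0) (U : (Fin n → ℝ) → ℝ≥0∞) : Prop where
  measurable : Measurable U
  maxFun_le : ∀ x, maxFun volume U x ≤ K * U x

lemma maxFun_tsum_le {F : ℕ → (Fin n → ℝ) → ℝ≥0∞} (hF : ∀ j, Measurable (F j)) (x : Fin n → ℝ) :
    maxFun volume (fun y => ∑' j, F j y) x ≤ ∑' j, maxFun volume (F j) x := by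
  refine maxFun_le fun c h hh hx => ?_
  rw [lintegral_tsum fun j => (hF j).aemeasurable, ← ENNReal.tsum_mul_left]
  exact ENNReal.tsum_le_tsum fun j => average_le_maxFun _ _ hh hx

lemma maxFun_const_mul_le {a : ℝ≥0∞} (ha : a ≠ ∞) (F : (Fin n → ℝ) → ℝ≥0∞) (x : Fin n → ℝ) :
    maxFun volume (fun y => a * F y) x ≤ a * maxFun volume F x := by
  refine maxFun_le fun c h hh hx => ?_
  rw [lintegral_const_mul' _ _ ha, mul_left_comm]
  gcongr
  exact average_le_maxFun _ _ hh hx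

/-- Jensen's inequality for a series with weights `b j`, which are not assumed to add up to one. -/
lemma tsum_mul_rpow_le {p : ℝ} (hp : 1 < p) (a b : ℕ → ℝ≥0∞) :
    (∑' j, b j * a j) ^ p ≤ (∑' j, b j) ^ (p - 1) * ∑' j, b j * a j ^ p := by
  have hp0 : 0 < p := by linarith
  have hp1 : 0 < p - 1 := by linarith
  have H := ENNReal.lintegral_mul_norm_pow_le (μ := Measure.count)
    (f := fun j : ℕ => b j * a j ^ p) (g := b) (measurable_of_countable _).aemeasurable
    (measurable_of_countable _).aemeasurable (p := 1 / p) (q := (p - 1) / p) (by positivity)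
    (by positivity) (by field_simp; ring)
  simp only [lintegral_count] at H
  have e : ∀ j, (b j * a j ^ p) ^ (1 / p) * b j ^ ((p - 1) / p) = b j * a j := by
    intro j
    rw [ENNReal.mul_rpow_of_nonneg _ _ (by positivity), ← ENNReal.rpow_mul,
      mul_one_div_cancel hp0.ne', ENNReal.rpow_one, mul_right_comm,
      ← ENNReal.rpow_add_of_nonneg _ _ (by positivity) (by positivity)]
    have : 1 / p + (p - 1) / p = 1 := by field_simp; ring
    rw [this, ENNReal.rpow_one]
  simp only [e] at H
  have := ENNReal.rpow_le_rpow H hp0.le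
  rwa [ENNReal.mul_rpow_of_nonneg _ _ hp0.le, ← ENNReal.rpow_mul, ← ENNReal.rpow_mul,
    one_div_mul_cancel hp0.ne', ENNReal.rpow_one, div_mul_cancel₀ _ hp0.ne', mul_comm] at this

/-- The **Rubio de Francia algorithm**: if the maximal operator has norm at most `N` on `L^p(w)`,
then every function has an `A_1` majorant of at most twice its norm in `L^p(w)`. -/
theorem exists_muckenhouptOne_majorant {p : ℝ} (hp : 1 < p) {N : ℝ≥0} (hN : N ≠ 0)
    {w : (Fin n → ℝ) → ℝ≥0∞} (hw : Measurable w)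
    (hM : ∀ F : (Fin n → ℝ) → ℝ≥0∞, Measurable F →
      ∫⁻ x, maxFun volume F x ^ p * w x ≤ (N : ℝ≥0∞) ^ p * ∫⁻ x, F x ^ p * w x)
    {F : (Fin n → ℝ) → ℝ≥0∞} (hF : Measurable F) :
    ∃ U : (Fin n → ℝ) → ℝ≥0∞, IsMuckenhouptOne (2 * N) U ∧ (∀ x, F x ≤ U x) ∧
      ∫⁻ x, U x ^ p * w x ≤ 2 ^ p * ∫⁻ x, F x ^ p * w x := by
  have hp0 : 0 < p := by linarith
  have hN0 : (N : ℝ≥0∞) ≠ 0 := by exact_mod_cast hN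
  have hN1 : (N : ℝ≥0∞) ≠ ∞ := ENNReal.coe_ne_top
  set I : ℕ → (Fin n → ℝ) → ℝ≥0∞ := fun j => (maxFun volume)^[j] F with hI
  have hIs : ∀ j, I (j + 1) = maxFun volume (I j) := fun j => Function.iterate_succ_apply' _ _ _
  have hIm : ∀ j, Measurable (I j) := by
    intro j
    cases j with
    | zero => exact hF
    | succ j => rw [hIs]; exact measurable_maxFun _ _
  have hIint : ∀ j, ∫⁻ x, I j x ^ p * w x ≤ ((N : ℝ≥0∞) ^ p) ^ j * ∫⁻ x, F x ^ p * w x := by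
    intro j
    induction j with
    | zero => simp [hI]
    | succ j ih =>
      rw [hIs, pow_succ', mul_assoc]
      exact (hM _ (hIm j)).trans (by gcongr)
  set b : ℕ → ℝ≥0∞ := fun j => (2⁻¹ : ℝ≥0∞) ^ j with hb
  have hb_sum : ∑' j, b j = 2 := by
    rw [hb, ENNReal.tsum_geometric, ENNReal.one_sub_inv_two, inv_inv]
  set a : ℕ → (Fin n → ℝ) → ℝ≥0∞ := fun j x => ((N : ℝ≥0∞)⁻¹) ^ j * I j x with ha
  have ham : ∀ j, Measurable (a j) := fun j => (hIm j).const_mul _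
  have hbtop : ∀ j, b j ≠ ∞ := fun j => ENNReal.pow_ne_top (by simp)
  have hNtop : ∀ j, ((N : ℝ≥0∞)⁻¹) ^ j ≠ ∞ := fun j => ENNReal.pow_ne_top (by simpa using hN)
  refine ⟨fun x => ∑' j, b j * a j x, ⟨?_, ?_⟩, ?_, ?_⟩
  · exact Measurable.tsum fun j => (ham j).const_mul _
  · intro x
    refine (maxFun_tsum_le (fun j => (ham j).const_mul _) x).trans ?_
    calc ∑' j, maxFun volume (fun y => b j * a j y) x
        ≤ ∑' j, ((2 * N : ℝ≥0) : ℝ≥0∞) * (b (j + 1) * a (j + 1) x) := by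
          refine ENNReal.tsum_le_tsum fun j => ?_
          refine (maxFun_const_mul_le (hbtop j) _ x).trans ?_
          have := maxFun_const_mul_le (hNtop j) (I j) x
          calc b j * maxFun volume (a j) x ≤ b j * (((N : ℝ≥0∞)⁻¹) ^ j * I (j + 1) x) := by
                rw [hIs]; gcongr
            _ = (2 * 2⁻¹) * (N * (N : ℝ≥0∞)⁻¹) * (b j * (((N : ℝ≥0∞)⁻¹) ^ j * I (j + 1) x)) := by
                rw [ENNReal.mul_inv_cancel hN0 hN1,
                  ENNReal.mul_inv_cancel (by norm_num) (by norm_num), one_mul, one_mul]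
            _ = _ := by
                simp only [hb, ha, pow_succ]
                push_cast
                ring
      _ = ((2 * N : ℝ≥0) : ℝ≥0∞) * ∑' j, b (j + 1) * a (j + 1) x := ENNReal.tsum_mul_left
      _ ≤ _ := by
          gcongr _ * ?_
          exact ENNReal.tsum_comp_le_tsum_of_injective (add_left_injective 1)
            (fun j => b j * a j x)
  · intro x
    refine le_trans ?_ (ENNReal.le_tsum 0)
    simp [hb, ha, hI]
  · calc ∫⁻ x, (∑' j, b j * a j x) ^ p * w x
        ≤ ∫⁻ x, 2 ^ (p - 1) * ∑' j, b j * (a j x ^ p * w x) := by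
          refine lintegral_mono fun x => ?_
          have := tsum_mul_rpow_le hp (fun j => a j x) b
          rw [hb_sum] at this
          simp only [← mul_assoc, ENNReal.tsum_mul_right] at this ⊢
          gcongr
      _ = 2 ^ (p - 1) * ∑' j, b j * ∫⁻ x, a j x ^ p * w x := by
          have hm : ∀ j, Measurable fun x => a j x ^ p * w x :=
            fun j => ((ham j).pow_const _).mul hw
          rw [lintegral_const_mul _ (Measurable.tsum fun j => (hm j).const_mul _),
            lintegral_tsum fun j => ((hm j).const_mul _).aemeasurable]
          simp only [lintegral_const_mul _ (hm _)]
      _ ≤ 2 ^ (p - 1) * ∑' j, b j * ∫⁻ x, F x ^ p * w x := by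
          gcongr _ * ?_
          refine ENNReal.tsum_le_tsum fun j => mul_le_mul_right ?_ _
          calc ∫⁻ x, a j x ^ p * w x
              = (((N : ℝ≥0∞)⁻¹) ^ j) ^ p * ∫⁻ x, I j x ^ p * w x := by
                rw [← lintegral_const_mul' _ _ (ENNReal.rpow_ne_top_of_nonneg hp0.le (hNtop j))]
                simp only [ha, ENNReal.mul_rpow_of_nonneg _ _ hp0.le, mul_assoc]
            _ ≤ (((N : ℝ≥0∞)⁻¹) ^ j) ^ p * (((N : ℝ≥0∞) ^ p) ^ j * ∫⁻ x, F x ^ p * w x) := by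
                gcongr
                exact hIint j
            _ = ∫⁻ x, F x ^ p * w x := by
                rw [← mul_assoc, ← ENNReal.rpow_natCast, ← ENNReal.rpow_natCast,
                  ← ENNReal.rpow_mul, ← ENNReal.rpow_mul, mul_comm (j : ℝ) p,
                  ← ENNReal.mul_rpow_of_nonneg _ _ (by positivity), ENNReal.inv_mul_cancel hN0 hN1,
                  ENNReal.one_rpow, one_mul]
      _ = 2 ^ p * ∫⁻ x, F x ^ p * w x := by
          rw [ENNReal.tsum_mul_right, hb_sum, ← mul_assoc]
          congr 1
          nth_rewrite 2 [← ENNReal.rpow_one 2]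
          rw [← ENNReal.rpow_add _ _ (by norm_num) (by norm_num), sub_add_cancel]

lemma iUnion_cube (x : Fin n → ℝ) : ⋃ N : ℕ, cube x (N + 1) = Set.univ := by
  refine Set.eq_univ_of_forall fun y => ?_
  obtain ⟨N, hN⟩ := exists_nat_ge (dist y x)
  refine Set.mem_iUnion.2 ⟨N, ?_⟩
  rw [cube_eq_ball x (by positivity)]
  exact Metric.mem_ball.2 (by linarith)

namespace IsMuckenhouptOne

variable {K : ℝ≥0} {U : (Fin n → ℝ) → ℝ≥0∞}

lemma setLIntegral_le (hU : IsMuckenhouptOne K U) {c x : Fin n → ℝ} {h : ℝ} (hh : 0 < h)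
    (hx : x ∈ cube c h) : ∫⁻ y in cube c h, U y ≤ K * volume (cube c h) * U x := by
  have h1 := (average_le_maxFun volume U hh hx).trans (hU.maxFun_le x)
  rw [← ENNReal.div_eq_inv_mul, ENNReal.div_le_iff (volume_cube_ne_zero c hh)
    (volume_cube_ne_top c hh)] at h1
  rwa [mul_right_comm]

/-- A function in `A_1` vanishes almost everywhere or nowhere. -/
lemma ae_eq_zero_or_ne_zero (hU : IsMuckenhouptOne K U) : U =ᵐ[volume] 0 ∨ ∀ x, U x ≠ 0 := by
  by_cases H : ∀ x, U x ≠ 0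
  · exact Or.inr H
  left
  push Not at H
  obtain ⟨x, hx⟩ := H
  have h1 : ∀ N : ℕ, ∀ᵐ y ∂(volume.restrict (cube x (N + 1))), U y = 0 := by
    intro N
    have hN : (0 : ℝ) < N + 1 := by positivity
    have := hU.setLIntegral_le hN (mem_cube_self x hN)
    rw [hx, mul_zero, nonpos_iff_eq_zero, lintegral_eq_zero_iff hU.measurable] at this
    exact this
  rwa [← ae_restrict_iUnion_iff, iUnion_cube, Measure.restrict_univ] at h1

lemma setLIntegral_ne_zero (hU : IsMuckenhouptOne K U) (hU0 : ∀ x, U x ≠ 0) (c : Fin n → ℝ)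
    {h : ℝ} (hh : 0 < h) : ∫⁻ y in cube c h, U y ≠ 0 := by
  intro h0
  rw [lintegral_eq_zero_iff hU.measurable] at h0
  have : ∀ᵐ x ∂(volume.restrict (cube c h)), False := by
    filter_upwards [h0] with x hx using hU0 x hx
  rw [ae_iff] at this
  simp [volume_cube_ne_zero c hh] at this

lemma setLIntegral_ne_top (hU : IsMuckenhouptOne K U) (hU1 : ∀ᵐ x, U x ≠ ∞) (c : Fin n → ℝ)
    {h : ℝ} (hh : 0 < h) : ∫⁻ y in cube c h, U y ≠ ∞ := by
  intro htop
  have : ∀ᵐ x ∂(volume.restrict (cube c h)), False := by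
    filter_upwards [ae_restrict_of_ae hU1, ae_restrict_mem (measurableSet_cube c h)] with x hx hxc
    have := hU.setLIntegral_le hh hxc
    rw [htop, top_le_iff] at this
    exact ENNReal.mul_ne_top (ENNReal.mul_ne_top ENNReal.coe_ne_top (volume_cube_ne_top c hh)) hx
      this
  rw [ae_iff] at this
  simp [volume_cube_ne_zero c hh] at this

/-- A negative power of a function in `A_1` is at most, on every cube, a constant times the same
power of its average. -/
lemma rpow_neg_le (hU : IsMuckenhouptOne K U) (hU0 : ∀ x, U x ≠ 0) (hU1 : ∀ᵐ x, U x ≠ ∞)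
    {t : ℝ} (ht : 0 ≤ t) {c x : Fin n → ℝ} {h : ℝ} (hh : 0 < h) (hx : x ∈ cube c h) :
    U x ^ (-t) ≤ (K * volume (cube c h)) ^ t * ((∫⁻ y in cube c h, U y) ^ t)⁻¹ := by
  have h0 := hU.setLIntegral_ne_zero hU0 c hh
  have h1 := hU.setLIntegral_ne_top hU1 c hh
  set u := ∫⁻ y in cube c h, U y
  have H := ENNReal.rpow_le_rpow (hU.setLIntegral_le hh hx) ht
  rw [ENNReal.mul_rpow_of_nonneg _ _ ht] at H
  rw [ENNReal.rpow_neg, ← div_eq_mul_inv, ENNReal.le_div_iff_mul_le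
    (Or.inl (by simp [h0, h1])) (Or.inl (ENNReal.rpow_ne_top_of_nonneg ht h1))]
  calc (U x ^ t)⁻¹ * u ^ t ≤ (U x ^ t)⁻¹ * ((K * volume (cube c h)) ^ t * U x ^ t) := by gcongr
    _ = ((U x ^ t)⁻¹ * U x ^ t) * (K * volume (cube c h)) ^ t := by ring
    _ ≤ 1 * (K * volume (cube c h)) ^ t := by gcongr; exact ENNReal.inv_mul_le_one _
    _ = _ := one_mul _

end IsMuckenhouptOne

/-! ### Extrapolation -/

lemma measurable_rpow_mul {F w : (Fin n → ℝ) → ℝ≥0∞} (hF : Measurable F) (hw : Measurable w)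
    (s : ℝ) : Measurable fun x => F x ^ s * w x :=
  (hF.pow_const s).mul hw

lemma IsMuckenhoupt.lintegral_rpow_mul_eq_zero_iff {q s : ℝ} (hs : 0 < s) {C : ℝ≥0}
    {w F : (Fin n → ℝ) → ℝ≥0∞} (hw : IsMuckenhoupt q C w) (hF : Measurable F) :
    ∫⁻ x, F x ^ s * w x = 0 ↔ F =ᵐ[volume] 0 := by
  rw [lintegral_eq_zero_iff (measurable_rpow_mul hF hw.measurable s)]
  constructor
  · intro h
    filter_upwards [h, hw.ne_zero] with x hx h0
    have : F x ^ s = 0 := (mul_eq_zero.1 hx).resolve_right h0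
    simpa [hs, not_lt.2 hs.le] using this
  · intro h
    filter_upwards [h] with x hx
    simp [hx, hs]

lemma IsMuckenhoupt.ae_ne_top_of_lintegral_rpow_mul_ne_top {p : ℝ} (hp : 0 < p) {C : ℝ≥0}
    {q : ℝ} {w U : (Fin n → ℝ) → ℝ≥0∞} (hw : IsMuckenhoupt q C w) (hU : Measurable U)
    (h : ∫⁻ x, U x ^ p * w x ≠ ∞) : ∀ᵐ x, U x ≠ ∞ := by
  filter_upwards [ae_lt_top ((hU.pow_const _).mul hw.measurable) h, hw.ne_zero] with x hx h0 htop
  rw [Pi.mul_apply, htop, ENNReal.top_rpow_of_pos hp, ENNReal.top_mul h0] at hx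
  exact lt_irrefl _ hx

/-- Multiplication by a negative power of an `A_1` function turns an `A_p` weight into an `A_r`
weight, for `p < r`. The total power of averages of `U` in the `A_r` condition is zero. -/
lemma IsMuckenhoupt.rpow_sub_mul_of_lt {p r : ℝ} (hp : 1 < p) (hpr : p < r) {C K : ℝ≥0}
    {w U : (Fin n → ℝ) → ℝ≥0∞} (hw : IsMuckenhoupt p C w) (hU : IsMuckenhouptOne K U)
    (hU0 : ∀ x, U x ≠ 0) (hU1 : ∀ᵐ x, U x ≠ ∞) :
    IsMuckenhoupt r (K ^ (r - p) * C) (fun x => U x ^ (p - r) * w x) where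
  measurable := (hU.measurable.pow_const _).mul hw.measurable
  ne_zero := by
    filter_upwards [hw.ne_zero, hU1] with x h0 h1
    simp [h0, h1, hU0 x]
  ne_top := by
    filter_upwards [hw.ne_top, hU1] with x h0 h1
    exact ENNReal.mul_ne_top (by simp [h1, hU0 x]) h0
  bound c h hh := by
    have hp1 : 0 < p - 1 := by linarith
    have hr1 : 0 < r - 1 := by linarith
    have hrp : 0 < r - p := by linarith
    have hu0 := hU.setLIntegral_ne_zero hU0 c hh
    have hu1 := hU.setLIntegral_ne_top hU1 c hh
    have hneg := fun x (hx : x ∈ cube c h) => hU.rpow_neg_le hU0 hU1 hrp.le hh hx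
    have hbound := hw.bound c h hh
    have hV0 := volume_cube_ne_zero c hh
    have hV1 := volume_cube_ne_top c hh
    set u := ∫⁻ y in cube c h, U y with hu
    set V := volume (cube c h) with hV
    set W := ∫⁻ x in cube c h, w x with hW
    set S := ∫⁻ x in cube c h, dualWeight p w x with hS
    have h1 : ∫⁻ x in cube c h, U x ^ (p - r) * w x ≤ (K * V) ^ (r - p) * (u ^ (r - p))⁻¹ * W := by
      rw [hW, ← lintegral_const_mul _ hw.measurable]
      refine setLIntegral_mono' (measurableSet_cube c h) fun x hx => ?_
      gcongr
      simpa using hneg x hx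
    have h2 : ∫⁻ x in cube c h, dualWeight r (fun x => U x ^ (p - r) * w x) x ≤
        u ^ ((r - p) / (r - 1)) * S ^ ((p - 1) / (r - 1)) := by
      refine le_trans (le_of_eq ?_) (ENNReal.lintegral_mul_norm_pow_le hU.measurable.aemeasurable
        hw.measurable_dualWeight.aemeasurable (by positivity) (by positivity)
        (by field_simp; ring))
      refine lintegral_congr_ae (ae_restrict_of_ae ?_)
      filter_upwards [hw.ne_zero, hw.ne_top, hU1] with x h0 h1 h2
      have hUt : U x ^ (p - r) ≠ ∞ := by simp [h2, hU0 x]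
      rw [dualWeight, dualWeight, ENNReal.mul_rpow_of_ne_top hUt h1, ← ENNReal.rpow_mul,
        ← ENNReal.rpow_mul]
      congr 2
      · field_simp; ring
      · field_simp
    have h2' : (∫⁻ x in cube c h, dualWeight r (fun x => U x ^ (p - r) * w x) x) ^ (r - 1) ≤
        u ^ (r - p) * S ^ (p - 1) := by
      refine (ENNReal.rpow_le_rpow h2 hr1.le).trans (le_of_eq ?_)
      rw [ENNReal.mul_rpow_of_nonneg _ _ hr1.le, ← ENNReal.rpow_mul, ← ENNReal.rpow_mul,
        div_mul_cancel₀ _ hr1.ne', div_mul_cancel₀ _ hr1.ne']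
    have hur0 : u ^ (r - p) ≠ 0 := by simp [hu0, hu1]
    have hur1 : u ^ (r - p) ≠ ∞ := ENNReal.rpow_ne_top_of_nonneg hrp.le hu1
    calc _ ≤ ((K * V) ^ (r - p) * (u ^ (r - p))⁻¹ * W) * (u ^ (r - p) * S ^ (p - 1)) := by gcongr
      _ = (K * V) ^ (r - p) * ((u ^ (r - p))⁻¹ * u ^ (r - p)) * (W * S ^ (p - 1)) := by ring
      _ ≤ (K * V) ^ (r - p) * ((u ^ (r - p))⁻¹ * u ^ (r - p)) * (C * V ^ p) := by gcongr
      _ = K ^ (r - p) * C * (V ^ (r - p) * V ^ p) := by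
          rw [ENNReal.inv_mul_cancel hur0 hur1, ENNReal.mul_rpow_of_nonneg _ _ hrp.le]
          ring
      _ = _ := by
          rw [← ENNReal.rpow_add _ _ hV0 hV1, sub_add_cancel]
          push_cast
          rw [ENNReal.coe_rpow_of_nonneg _ hrp.le]

/-- A weighted geometric mean of an `A_1` function and an `A_p` weight is an `A_r` weight, for
`r < p`. -/
lemma IsMuckenhoupt.rpow_mul_rpow_of_lt {p r : ℝ} (hr : 1 < r) (hrp : r < p) {C K : ℝ≥0}
    {w U : (Fin n → ℝ) → ℝ≥0∞} (hw : IsMuckenhoupt p C w) (hU : IsMuckenhouptOne K U)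
    (hU0 : ∀ x, U x ≠ 0) (hU1 : ∀ᵐ x, U x ≠ ∞) :
    IsMuckenhoupt r (K ^ ((p - r) / (p - 1)) * C ^ ((r - 1) / (p - 1)))
      (fun x => U x ^ ((p - r) / (p - 1)) * w x ^ ((r - 1) / (p - 1))) where
  measurable := (hU.measurable.pow_const _).mul (hw.measurable.pow_const _)
  ne_zero := by
    filter_upwards [hw.ne_zero, hw.ne_top, hU1] with x h0 h0' h1
    simp [h0, h0', h1, hU0 x]
  ne_top := by
    filter_upwards [hw.ne_zero, hw.ne_top, hU1] with x h0 h0' h1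
    exact ENNReal.mul_ne_top (by simp [h1, hU0 x]) (by simp [h0, h0'])
  bound c h hh := by
    have hp1 : 0 < p - 1 := by linarith
    have hr1 : 0 < r - 1 := by linarith
    have hpr : 0 < p - r := by linarith
    set θ := (p - r) / (p - 1) with hθ
    set η := (r - 1) / (p - 1) with hη
    have hθ0 : 0 < θ := by positivity
    have hη0 : 0 < η := by positivity
    have hθη : θ + η = 1 := by rw [hθ, hη]; field_simp; ring
    have hu0 := hU.setLIntegral_ne_zero hU0 c hh
    have hu1 := hU.setLIntegral_ne_top hU1 c hh
    have hneg := fun x (hx : x ∈ cube c h) =>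
      hU.rpow_neg_le hU0 hU1 (t := θ / (r - 1)) (by positivity) hh hx
    have hbound := hw.bound c h hh
    have hV0 := volume_cube_ne_zero c hh
    have hV1 := volume_cube_ne_top c hh
    set u := ∫⁻ y in cube c h, U y with hu
    set V := volume (cube c h) with hV
    set W := ∫⁻ x in cube c h, w x with hW
    set S := ∫⁻ x in cube c h, dualWeight p w x with hS
    have h1 : ∫⁻ x in cube c h, U x ^ θ * w x ^ η ≤ u ^ θ * W ^ η :=
      ENNReal.lintegral_mul_norm_pow_le hU.measurable.aemeasurable hw.measurable.aemeasurable
        hθ0.le hη0.le hθη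
    have h2 : ∫⁻ x in cube c h, dualWeight r (fun x => U x ^ θ * w x ^ η) x ≤
        (K * V) ^ (θ / (r - 1)) * (u ^ (θ / (r - 1)))⁻¹ * S := by
      rw [hS, ← lintegral_const_mul _ hw.measurable_dualWeight]
      refine lintegral_mono_ae ?_
      filter_upwards [ae_restrict_mem (measurableSet_cube c h), ae_restrict_of_ae hw.ne_zero,
        ae_restrict_of_ae hw.ne_top, ae_restrict_of_ae hU1] with x hx h0 h1 h2
      have hUt : U x ^ θ ≠ ∞ := by simp [h2, hU0 x]
      have hwt : w x ^ η ≠ ∞ := by simp [h0, h1]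
      rw [dualWeight, dualWeight, ENNReal.mul_rpow_of_ne_top hUt hwt, ← ENNReal.rpow_mul,
        ← ENNReal.rpow_mul]
      have e1 : θ * -(1 / (r - 1)) = -(θ / (r - 1)) := by ring
      have e2 : η * -(1 / (r - 1)) = -(1 / (p - 1)) := by rw [hη]; field_simp
      rw [e1, e2]
      gcongr
      exact hneg x hx
    have h2' : (∫⁻ x in cube c h, dualWeight r (fun x => U x ^ θ * w x ^ η) x) ^ (r - 1) ≤
        (K * V) ^ θ * (u ^ θ)⁻¹ * (S ^ (p - 1)) ^ η := by
      refine (ENNReal.rpow_le_rpow h2 hr1.le).trans (le_of_eq ?_)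
      rw [ENNReal.mul_rpow_of_nonneg _ _ hr1.le, ENNReal.mul_rpow_of_nonneg _ _ hr1.le,
        ENNReal.inv_rpow, ← ENNReal.rpow_mul, ← ENNReal.rpow_mul, ← ENNReal.rpow_mul,
        div_mul_cancel₀ _ hr1.ne', hη, mul_div_cancel₀ _ hp1.ne']
    have hur0 : u ^ θ ≠ 0 := by simp [hu0, hu1]
    have hur1 : u ^ θ ≠ ∞ := ENNReal.rpow_ne_top_of_nonneg hθ0.le hu1
    calc _ ≤ (u ^ θ * W ^ η) * ((K * V) ^ θ * (u ^ θ)⁻¹ * (S ^ (p - 1)) ^ η) := by gcongr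
      _ = (K * V) ^ θ * ((u ^ θ)⁻¹ * u ^ θ) * (W ^ η * (S ^ (p - 1)) ^ η) := by ring
      _ = (K * V) ^ θ * (W * S ^ (p - 1)) ^ η := by
          rw [ENNReal.inv_mul_cancel hur0 hur1, mul_one, ENNReal.mul_rpow_of_nonneg W _ hη0.le]
      _ ≤ (K * V) ^ θ * (C * V ^ p) ^ η := by gcongr
      _ = K ^ θ * C ^ η * (V ^ θ * V ^ (p * η)) := by
          rw [ENNReal.mul_rpow_of_nonneg _ _ hθ0.le, ENNReal.mul_rpow_of_nonneg _ _ hη0.le,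
            ← ENNReal.rpow_mul]
          ring
      _ = _ := by
          rw [← ENNReal.rpow_add _ _ hV0 hV1]
          push_cast
          rw [ENNReal.coe_rpow_of_nonneg _ hθ0.le, ENNReal.coe_rpow_of_nonneg _ hη0.le]
          congr 2
          rw [hθ, hη]
          field_simp
          ring

lemma isMuckenhouptOne_one {K : ℝ≥0} (hK : 1 ≤ K) :
    IsMuckenhouptOne K (fun _ : Fin n → ℝ => 1) where
  measurable := measurable_const
  maxFun_le x := by
    refine maxFun_le fun c h hh hx => ?_
    rw [setLIntegral_one, mul_one]
    exact (ENNReal.inv_mul_le_one _).trans (by exact_mod_cast hK)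

/-- For the weights of one class `A_p`, the Rubio de Francia algorithm gives `A_1` majorants with
one and the same constant. -/
lemma exists_forall_muckenhouptOne_majorant (n : ℕ) {p : ℝ} (hp : 1 < p) (C : ℝ≥0) :
    ∃ K : ℝ≥0, 1 ≤ K ∧ ∀ w : (Fin n → ℝ) → ℝ≥0∞, IsMuckenhoupt p C w →
      ∀ F : (Fin n → ℝ) → ℝ≥0∞, Measurable F → ∃ U : (Fin n → ℝ) → ℝ≥0∞,
        IsMuckenhouptOne K U ∧ (∀ x, F x ≤ U x) ∧
          ∫⁻ x, U x ^ p * w x ≤ 2 ^ p * ∫⁻ x, F x ^ p * w x := by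
  have hp0 : 0 < p := by linarith
  obtain ⟨N, hN⟩ := exists_lintegral_maxFun_rpow_mul_le n C hp
  refine ⟨2 * (N ^ p⁻¹ + 1), ?_, fun w hw F hF => ?_⟩
  · calc (1 : ℝ≥0) ≤ 2 * (0 + 1) := by norm_num
      _ ≤ _ := by gcongr; exact zero_le
  · refine exists_muckenhouptOne_majorant hp (by positivity) hw.measurable (fun F hF => ?_) hF
    refine (hN w hw F hF).trans ?_
    gcongr
    rw [← ENNReal.coe_rpow_of_nonneg _ hp0.le, ENNReal.coe_le_coe, ← NNReal.rpow_inv_le_iff hp0]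
    exact le_self_add

/-- Extrapolation to smaller exponents: dividing by the right power of an `A_1` majorant of `F`
turns the given `A_p` weight into an `A_r` weight. -/
theorem exists_extrapolation_of_lt (n : ℕ) {p r : ℝ} (hp : 1 < p) (hpr : p < r) (C : ℝ≥0) :
    ∃ C' : ℝ≥0, ∀ N : ℝ≥0, ∃ N' : ℝ≥0, ∀ w : (Fin n → ℝ) → ℝ≥0∞, IsMuckenhoupt p C w →
      ∀ F G : (Fin n → ℝ) → ℝ≥0∞, Measurable F → Measurable G →
        (∀ W : (Fin n → ℝ) → ℝ≥0∞, IsMuckenhoupt r C' W →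
          ∫⁻ x, G x ^ r * W x ≤ N * ∫⁻ x, F x ^ r * W x) →
        ∫⁻ x, G x ^ p * w x ≤ N' * ∫⁻ x, F x ^ p * w x := by
  have hp0 : 0 < p := by linarith
  have hr0 : 0 < r := by linarith
  have hrp : 0 < r - p := by linarith
  obtain ⟨K, hK1, hK⟩ := exists_forall_muckenhouptOne_majorant n hp C
  refine ⟨K ^ (r - p) * C, fun N => ⟨N ^ (p / r) * (2 ^ p) ^ ((r - p) / r) + 1,
    fun w hw F G hF hG H => ?_⟩⟩
  set X := ∫⁻ x, F x ^ p * w x with hX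
  by_cases hXtop : X = ∞
  · rw [hXtop, ENNReal.mul_top (by simp)]
    exact le_top
  obtain ⟨U, hU, hFU, hUint⟩ := hK w hw F hF
  have hUtop : ∀ᵐ x, U x ≠ ∞ := by
    refine hw.ae_ne_top_of_lintegral_rpow_mul_ne_top hp0 hU.measurable
      (ne_top_of_le_ne_top ?_ hUint)
    exact ENNReal.mul_ne_top (ENNReal.rpow_ne_top_of_nonneg hp0.le (by norm_num)) hXtop
  rcases hU.ae_eq_zero_or_ne_zero with hU0 | hU0
  · -- Here `F` vanishes, and any `A_r` weight shows that so does `G`.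
    have hW := hw.rpow_sub_mul_of_lt hp hpr (isMuckenhouptOne_one hK1) (by simp) (by simp)
    have h1 := H _ hW
    have hF0 : F =ᵐ[volume] 0 := by
      filter_upwards [hU0] with x hx
      exact le_antisymm ((hFU x).trans_eq hx) zero_le
    rw [(hW.lintegral_rpow_mul_eq_zero_iff hr0 hF).2 hF0, mul_zero, nonpos_iff_eq_zero,
      hW.lintegral_rpow_mul_eq_zero_iff hr0 hG] at h1
    rw [(hw.lintegral_rpow_mul_eq_zero_iff hp0 hG).2 h1]
    exact zero_le
  · have hW := hw.rpow_sub_mul_of_lt hp hpr hU hU0 hUtop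
    have h1 := H _ hW
    have h2 : ∫⁻ x, F x ^ r * (U x ^ (p - r) * w x) ≤ X := by
      refine lintegral_mono fun x => ?_
      rw [← mul_assoc]
      gcongr
      by_cases hF0 : F x = 0
      · simp [hF0, hr0]
      by_cases hF1 : F x = ∞
      · have : U x = ∞ := top_le_iff.1 (hF1 ▸ hFU x)
        rw [this, ENNReal.top_rpow_of_neg (by linarith), mul_zero]
        exact zero_le
      calc F x ^ r * U x ^ (p - r) ≤ F x ^ r * F x ^ (p - r) := by
            rw [← neg_sub r p, ENNReal.rpow_neg, ENNReal.rpow_neg]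
            gcongr
            exact hFU x
        _ = F x ^ p := by rw [← ENNReal.rpow_add _ _ hF0 hF1]; congr 1; ring
    calc ∫⁻ x, G x ^ p * w x
        = ∫⁻ x, (G x ^ r * (U x ^ (p - r) * w x)) ^ (p / r) * (U x ^ p * w x) ^ ((r - p) / r) := by
          refine lintegral_congr_ae ?_
          filter_upwards [hw.ne_zero, hw.ne_top, hUtop] with x h0 h1 h2
          have hpr' : 0 ≤ p / r := by positivity
          have hpr'' : 0 ≤ (r - p) / r := by positivity
          rw [ENNReal.mul_rpow_of_nonneg _ _ hpr', ENNReal.mul_rpow_of_nonneg _ _ hpr',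
            ENNReal.mul_rpow_of_nonneg _ _ hpr'', ← ENNReal.rpow_mul, ← ENNReal.rpow_mul,
            ← ENNReal.rpow_mul, mul_div_cancel₀ _ hr0.ne']
          calc G x ^ p * w x = G x ^ p * (U x ^ (0 : ℝ) * w x ^ (1 : ℝ)) := by simp
            _ = G x ^ p * (U x ^ ((p - r) * (p / r) + p * ((r - p) / r)) *
                w x ^ (p / r + (r - p) / r)) := by
                congr 3
                · field_simp; ring
                · field_simp; ring
            _ = _ := by
                rw [ENNReal.rpow_add _ _ (hU0 x) h2, ENNReal.rpow_add _ _ h0 h1]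
                ring
      _ ≤ (∫⁻ x, G x ^ r * (U x ^ (p - r) * w x)) ^ (p / r) *
          (∫⁻ x, U x ^ p * w x) ^ ((r - p) / r) :=
          ENNReal.lintegral_mul_norm_pow_le ((hG.pow_const _).mul hW.measurable).aemeasurable
            ((hU.measurable.pow_const _).mul hw.measurable).aemeasurable (by positivity)
            (by positivity) (by field_simp; ring)
      _ ≤ (N * X) ^ (p / r) * (2 ^ p * X) ^ ((r - p) / r) := by
          gcongr
          exact h1.trans (by gcongr)
      _ = N ^ (p / r) * (2 ^ p) ^ ((r - p) / r) * (X ^ (p / r) * X ^ ((r - p) / r)) := by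
          rw [ENNReal.mul_rpow_of_nonneg _ _ (by positivity),
            ENNReal.mul_rpow_of_nonneg _ _ (by positivity)]
          ring
      _ = N ^ (p / r) * (2 ^ p) ^ ((r - p) / r) * X := by
          rw [← ENNReal.rpow_add_of_nonneg _ _ (by positivity) (by positivity)]
          have : p / r + (r - p) / r = 1 := by field_simp; ring
          rw [this, ENNReal.rpow_one]
      _ ≤ _ := by
          gcongr
          push_cast
          rw [ENNReal.coe_rpow_of_nonneg _ (by positivity : (0 : ℝ) ≤ p / r),
            ENNReal.coe_rpow_of_nonneg _ (by positivity : (0 : ℝ) ≤ (r - p) / r),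
            ENNReal.coe_rpow_of_nonneg _ hp0.le]
          exact le_self_add

lemma exists_measurable_lt_lintegral {α : Type*} [MeasurableSpace α] {μ : Measure α}
    [SigmaFinite μ] {f : α → ℝ≥0∞} {L : ℝ≥0∞} (hL : L < ∫⁻ x, f x ∂μ) :
    ∃ g : α → ℝ≥0∞, Measurable g ∧ (∀ x, g x ≤ f x) ∧ ∫⁻ x, g x ∂μ < ∞ ∧ L < ∫⁻ x, g x ∂μ := by
  rw [lintegral_eq_nnreal] at hL
  simp only [lt_iSup_iff] at hL
  obtain ⟨φ, hφ, hL⟩ := hL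
  rw [← SimpleFunc.lintegral_eq_lintegral] at hL
  obtain ⟨g, hg, h1, h2⟩ := SimpleFunc.exists_lt_lintegral_simpleFunc_of_lt_lintegral
    (f := φ) (by simpa using hL)
  exact ⟨fun x => g x, g.measurable.coe_nnreal_ennreal,
    fun x => (ENNReal.coe_le_coe.2 (hg x)).trans (hφ x), h1, h2⟩

/-- Extrapolation to larger exponents. The functions `g ≤ G ^ p` of finite integral replace the
functions of the dual space: an `A_1` majorant of `g ^ ((p - 1) / p) * w`, formed in the dual
`L^{p'}`, has a geometric mean with `w` which is an `A_r` weight. -/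
theorem exists_extrapolation_of_gt (n : ℕ) {p r : ℝ} (hr : 1 < r) (hrp : r < p) (C : ℝ≥0) :
    ∃ C' : ℝ≥0, ∀ N : ℝ≥0, ∃ N' : ℝ≥0, ∀ w : (Fin n → ℝ) → ℝ≥0∞, IsMuckenhoupt p C w →
      ∀ F G : (Fin n → ℝ) → ℝ≥0∞, Measurable F → Measurable G →
        (∀ W : (Fin n → ℝ) → ℝ≥0∞, IsMuckenhoupt r C' W →
          ∫⁻ x, G x ^ r * W x ≤ N * ∫⁻ x, F x ^ r * W x) →
        ∫⁻ x, G x ^ p * w x ≤ N' * ∫⁻ x, F x ^ p * w x := by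
  have hp : 1 < p := by linarith
  have hp0 : 0 < p := by linarith
  have hr0 : 0 < r := by linarith
  have hp1 : 0 < p - 1 := by linarith
  have hr1 : 0 < r - 1 := by linarith
  have hpr : 0 < p - r := by linarith
  have hp' : 1 < p / (p - 1) := by rw [one_lt_div hp1]; linarith
  have hp'0 : 0 < p / (p - 1) := by linarith
  set θ := (p - r) / (p - 1) with hθ
  set η := (r - 1) / (p - 1) with hη
  have hθ0 : 0 < θ := by positivity
  have hη0 : 0 < η := by positivity
  have hθη : θ + η = 1 := by rw [hθ, hη]; field_simp; ring
  obtain ⟨K, hK1, hK⟩ := exists_forall_muckenhouptOne_majorant n hp' (C ^ (1 / (p - 1)))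
  refine ⟨K ^ θ * C ^ η, fun N => ⟨(N * 2 ^ θ) ^ (p / r), fun w hw F G hF hG H => ?_⟩⟩
  have hσ := hw.dual hp
  have := hw.sigmaFinite
  set Y := ∫⁻ x, F x ^ p * w x with hY
  rw [← lintegral_weight hw.measurable (hG.pow_const p)]
  refine le_of_forall_lt fun L hL => ?_
  obtain ⟨g, hgm, hgG, hXtop, hLX⟩ := exists_measurable_lt_lintegral hL
  refine hLX.trans_le ?_
  rw [lintegral_weight hw.measurable hgm] at hXtop hLX ⊢
  set X := ∫⁻ x, g x * w x with hX
  have hX0 : X ≠ 0 := fun h => by simp [h] at hLX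
  set f : (Fin n → ℝ) → ℝ≥0∞ := fun x => g x ^ ((p - 1) / p) * w x with hf
  have hfm : Measurable f := (hgm.pow_const _).mul hw.measurable
  obtain ⟨U, hU, hfU, hUint⟩ := hK _ hσ f hfm
  have hfX : ∫⁻ x, f x ^ (p / (p - 1)) * dualWeight p w x = X := by
    refine lintegral_congr_ae ?_
    filter_upwards [hw.ne_zero, hw.ne_top] with x h0 h1
    have e1 : (p - 1) / p * (p / (p - 1)) = 1 := by field_simp
    rw [hf, dualWeight, ENNReal.mul_rpow_of_nonneg _ _ hp'0.le, ← ENNReal.rpow_mul, e1,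
      ENNReal.rpow_one, mul_assoc, ← ENNReal.rpow_add _ _ h0 h1]
    have e2 : p / (p - 1) + -(1 / (p - 1)) = 1 := by field_simp; ring
    rw [e2, ENNReal.rpow_one]
  rw [hfX] at hUint
  have hUtop : ∀ᵐ x, U x ≠ ∞ := by
    refine hσ.ae_ne_top_of_lintegral_rpow_mul_ne_top hp'0 hU.measurable
      (ne_top_of_le_ne_top ?_ hUint)
    exact ENNReal.mul_ne_top (ENNReal.rpow_ne_top_of_nonneg hp'0.le (by norm_num)) hXtop.ne
  have hU0 : ∀ x, U x ≠ 0 := by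
    refine hU.ae_eq_zero_or_ne_zero.resolve_left fun hU0 => hX0 ?_
    rw [← hfX, hσ.lintegral_rpow_mul_eq_zero_iff hp'0 hfm]
    filter_upwards [hU0] with x hx
    exact le_antisymm ((hfU x).trans_eq hx) zero_le
  have hV := hw.rpow_mul_rpow_of_lt hr hrp hU hU0 hUtop
  have h1 : X ≤ N * ∫⁻ x, F x ^ r * (U x ^ θ * w x ^ η) := by
    refine le_trans (lintegral_mono_ae ?_) (H _ hV)
    filter_upwards [hw.ne_zero, hw.ne_top] with x h0 h1
    have hGr : g x ^ (r / p) ≤ G x ^ r := by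
      refine (ENNReal.rpow_le_rpow (hgG x) (by positivity)).trans_eq ?_
      rw [← ENNReal.rpow_mul, mul_div_cancel₀ _ hp0.ne']
    calc g x * w x = g x ^ (r / p + (p - r) / p) * w x ^ (θ + η) := by
          have : r / p + (p - r) / p = 1 := by field_simp; ring
          rw [this, hθη, ENNReal.rpow_one, ENNReal.rpow_one]
      _ = g x ^ (r / p) * (f x ^ θ * w x ^ η) := by
          rw [ENNReal.rpow_add_of_nonneg _ _ (by positivity) (by positivity),
            ENNReal.rpow_add_of_nonneg _ _ hθ0.le hη0.le, hf,
            ENNReal.mul_rpow_of_nonneg _ _ hθ0.le, ← ENNReal.rpow_mul]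
          have : (p - 1) / p * θ = (p - r) / p := by rw [hθ]; field_simp
          rw [this]
          ring
      _ ≤ G x ^ r * (U x ^ θ * w x ^ η) := by
          gcongr
          exact hfU x
  have h2 : ∫⁻ x, F x ^ r * (U x ^ θ * w x ^ η) ≤
      Y ^ (r / p) * (2 ^ (p / (p - 1)) * X) ^ ((p - r) / p) := by
    calc ∫⁻ x, F x ^ r * (U x ^ θ * w x ^ η)
        = ∫⁻ x, (F x ^ p * w x) ^ (r / p) *
            (U x ^ (p / (p - 1)) * dualWeight p w x) ^ ((p - r) / p) := by
          refine lintegral_congr_ae ?_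
          filter_upwards [hw.ne_zero, hw.ne_top] with x h0 h1
          have hrp' : 0 ≤ r / p := by positivity
          have hrp'' : 0 ≤ (p - r) / p := by positivity
          rw [ENNReal.mul_rpow_of_nonneg _ _ hrp', ENNReal.mul_rpow_of_nonneg _ _ hrp'', dualWeight,
            ← ENNReal.rpow_mul, ← ENNReal.rpow_mul, ← ENNReal.rpow_mul, mul_div_cancel₀ _ hp0.ne']
          have e1 : p / (p - 1) * ((p - r) / p) = θ := by rw [hθ]; field_simp
          have e2 : η = r / p + -(1 / (p - 1)) * ((p - r) / p) := by rw [hη]; field_simp; ring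
          rw [e1, e2, ENNReal.rpow_add _ _ h0 h1]
          ring
      _ ≤ Y ^ (r / p) * (∫⁻ x, U x ^ (p / (p - 1)) * dualWeight p w x) ^ ((p - r) / p) :=
          ENNReal.lintegral_mul_norm_pow_le ((hF.pow_const _).mul hw.measurable).aemeasurable
            ((hU.measurable.pow_const _).mul hσ.measurable).aemeasurable (by positivity)
            (by positivity) (by field_simp; ring)
      _ ≤ _ := by gcongr
  -- Since `X` is finite and positive, its power on the right can be absorbed.
  have h3 : X ^ (r / p) ≤ N * 2 ^ θ * Y ^ (r / p) := by
    have hs0 : X ^ ((p - r) / p) ≠ 0 := by simp [hX0, hXtop.ne]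
    have hs1 : X ^ ((p - r) / p) ≠ ∞ := ENNReal.rpow_ne_top_of_nonneg (by positivity) hXtop.ne
    rw [← ENNReal.mul_le_mul_iff_left hs0 hs1,
      ← ENNReal.rpow_add_of_nonneg _ _ (by positivity) (by positivity)]
    have e1 : r / p + (p - r) / p = 1 := by field_simp; ring
    rw [e1, ENNReal.rpow_one]
    refine h1.trans ((mul_le_mul_right h2 _).trans (le_of_eq ?_))
    rw [ENNReal.mul_rpow_of_nonneg _ _ (by positivity), ← ENNReal.rpow_mul]
    have e2 : p / (p - 1) * ((p - r) / p) = θ := by rw [hθ]; field_simp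
    rw [e2]
    ring
  have h4 := ENNReal.rpow_le_rpow h3 (by positivity : (0 : ℝ) ≤ p / r)
  have e3 : r / p * (p / r) = 1 := by field_simp
  rw [ENNReal.mul_rpow_of_nonneg _ _ (by positivity), ← ENNReal.rpow_mul, ← ENNReal.rpow_mul, e3,
    ENNReal.rpow_one, ENNReal.rpow_one] at h4
  rw [ENNReal.coe_rpow_of_nonneg _ (by positivity : (0 : ℝ) ≤ p / r)]
  push_cast
  rwa [ENNReal.coe_rpow_of_nonneg _ hθ0.le]

/-- **Rubio de Francia's extrapolation theorem**, from weights in `A_r` to weights in `A_p`. -/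
theorem exists_extrapolation (n : ℕ) {p r : ℝ} (hp : 1 < p) (hr : 1 < r) (C : ℝ≥0) :
    ∃ C' : ℝ≥0, ∀ N : ℝ≥0, ∃ N' : ℝ≥0, ∀ w : (Fin n → ℝ) → ℝ≥0∞, IsMuckenhoupt p C w →
      ∀ F G : (Fin n → ℝ) → ℝ≥0∞, Measurable F → Measurable G →
        (∀ W : (Fin n → ℝ) → ℝ≥0∞, IsMuckenhoupt r C' W →
          ∫⁻ x, G x ^ r * W x ≤ N * ∫⁻ x, F x ^ r * W x) →
        ∫⁻ x, G x ^ p * w x ≤ N' * ∫⁻ x, F x ^ p * w x := by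
  rcases lt_trichotomy p r with h | rfl | h
  · exact exists_extrapolation_of_lt n hp h C
  · exact ⟨C, fun N => ⟨N, fun w hw F G _ _ H => H w hw⟩⟩
  · exact exists_extrapolation_of_gt n hr h C

lemma measurable_seqNorm {r : ℝ} {g : ℕ → (Fin n → ℝ) → ℝ≥0∞} (hg : ∀ k, Measurable (g k)) :
    Measurable (seqNorm r g) :=
  (Measurable.tsum fun k => (hg k).pow_const r).pow_const _

lemma seqNorm_rpow {r : ℝ} (hr : r ≠ 0) (g : ℕ → (Fin n → ℝ) → ℝ≥0∞) (x : Fin n → ℝ) :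
    seqNorm r g x ^ r = ∑' k, g k x ^ r := by
  rw [seqNorm, ← ENNReal.rpow_mul, one_div_mul_cancel hr, ENNReal.rpow_one]

/-- The weighted **Fefferman-Stein inequality**. For `p = r` it is Muckenhoupt's theorem, summed
over the sequence; the other exponents follow by extrapolation. -/
theorem exists_lintegral_seqNorm_maxFun_le (n : ℕ) {p r : ℝ} (hp : 1 < p) (hr : 1 < r) (C : ℝ≥0) :
    ∃ N : ℝ≥0, ∀ w : (Fin n → ℝ) → ℝ≥0∞, IsMuckenhoupt p C w →
      ∀ g : ℕ → (Fin n → ℝ) → ℝ≥0∞, (∀ k, Measurable (g k)) →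
        ∫⁻ x, seqNorm r (fun k => maxFun volume (g k)) x ^ p * w x ≤
          N * ∫⁻ x, seqNorm r g x ^ p * w x := by
  have hr0 : r ≠ 0 := by linarith
  obtain ⟨C', hC'⟩ := exists_extrapolation n hp hr C
  obtain ⟨N, hN⟩ := exists_lintegral_maxFun_rpow_mul_le n C' hr
  obtain ⟨N', hN'⟩ := hC' N
  refine ⟨N', fun w hw g hg => hN' w hw _ _ (measurable_seqNorm hg)
    (measurable_seqNorm fun k => measurable_maxFun _ _) fun W hW => ?_⟩
  simp only [seqNorm_rpow hr0, ← ENNReal.tsum_mul_right]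
  rw [lintegral_tsum fun k =>
      (measurable_rpow_mul (measurable_maxFun _ _) hW.measurable r).aemeasurable,
    lintegral_tsum fun k => (measurable_rpow_mul (hg k) hW.measurable r).aemeasurable,
    ← ENNReal.tsum_mul_left]
  exact ENNReal.tsum_le_tsum fun k => hN W hW (g k) (hg k)

/-! ### Comparison of the norms -/

lemma weightMeasure_cube_ne_top {ω : (Fin n → ℝ) → ℝ} (hω : LocallyIntegrable ω volume)
    (c : Fin n → ℝ) {h : ℝ} (hh : 0 < h) : weightMeasure ω (cube c h) ≠ ∞ := by
  have h1 : IntegrableOn ω (cube c h) volume :=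
    (hω.integrableOn_isCompact (isCompact_closedBall c h)).mono_set
      (by rw [cube_eq_ball c hh]; exact Metric.ball_subset_closedBall)
  rw [weightMeasure, withDensity_cube]
  exact h1.lintegral_lt_top.ne

lemma weightMeasure_absolutelyContinuous (ω : (Fin n → ℝ) → ℝ) : weightMeasure ω ≪ volume :=
  withDensity_absolutelyContinuous _ _

/-- Chebyshev's inequality `‖F‖_{p,∞} ≤ ‖F‖_p`. -/
lemma weakLebesgueNorm_le_lebesgueNorm (ω : (Fin n → ℝ) → ℝ) {p : ℝ} (hp : 0 < p)
    {F : (Fin n → ℝ) → ℝ≥0∞} (hF : Measurable F) :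
    weakLebesgueNorm ω p F ≤ lebesgueNorm ω p F := by
  refine iSup₂_le fun t ht => ?_
  set A := lebesgueNorm ω p F with hA
  by_cases hAtop : A = ∞
  · rw [hAtop]; exact le_top
  have hAp : A ^ p = ∫⁻ x, F x ^ p ∂(weightMeasure ω) := by
    rw [hA, lebesgueNorm, ← ENNReal.rpow_mul, one_div_mul_cancel hp.ne', ENNReal.rpow_one]
  have ht0 : ENNReal.ofReal t ≠ 0 := by simpa using ht
  have ht1 : ENNReal.ofReal t ≠ ∞ := ENNReal.ofReal_ne_top
  set τ := ENNReal.ofReal t ^ (1 / p) with hτ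
  have hτ0 : τ ≠ 0 := by simp [hτ, ht0, hp]
  have hτ1 : τ ≠ ∞ := ENNReal.rpow_ne_top_of_nonneg (by positivity) ht1
  have hτp : τ ^ p = ENNReal.ofReal t := by
    rw [hτ, ← ENNReal.rpow_mul, one_div_mul_cancel hp.ne', ENNReal.rpow_one]
  rw [mul_comm, ← ENNReal.le_div_iff_mul_le (Or.inl hτ0) (Or.inl hτ1)]
  -- Heights slightly above `A / τ` are admissible, also when `A = 0`.
  refine le_of_forall_gt_imp_ge_of_dense fun s hs => sInf_le ⟨hs.trans_le' zero_le, ?_⟩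
  have hs0 : s ≠ 0 := (hs.trans_le' zero_le).ne'
  by_cases hs1 : s = ∞
  · simp [distribution, hs1]
  have hsp0 : s ^ p ≠ 0 := by simp [hs0, hs1]
  have hsp1 : s ^ p ≠ ∞ := ENNReal.rpow_ne_top_of_nonneg hp.le hs1
  have h1 : A ^ p ≤ s ^ p * ENNReal.ofReal t := by
    rw [← hτp, ← ENNReal.mul_rpow_of_nonneg _ _ hp.le]
    exact ENNReal.rpow_le_rpow ((ENNReal.div_le_iff hτ0 hτ1).1 hs.le) hp.le
  have h2 : s ^ p * distribution ω F s ≤ A ^ p := by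
    rw [hAp]
    refine le_trans ?_ (mul_meas_ge_le_lintegral (hF.pow_const p) (s ^ p))
    exact mul_le_mul_right (measure_mono fun x hx => ENNReal.rpow_le_rpow (le_of_lt hx) hp.le) _
  exact (ENNReal.mul_le_mul_iff_right hsp0 hsp1).1 (h2.trans h1)

/-- The weak norm, defined through the rearrangement, controls the distribution function. -/
lemma distribution_le (ω : (Fin n → ℝ) → ℝ) {p : ℝ} (hp : 0 < p) (F : (Fin n → ℝ) → ℝ≥0∞) {s : ℝ}
    (hs : 0 < s) :
    distribution ω F (ENNReal.ofReal s) ≤ (weakLebesgueNorm ω p F / ENNReal.ofReal s) ^ p := by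
  refine ENNReal.le_of_forall_nnreal_lt fun t ht => ?_
  rcases eq_or_ne t 0 with rfl | ht0
  · exact zero_le
  have hs0 : ENNReal.ofReal s ≠ 0 := by simpa using hs
  have h1 : ENNReal.ofReal s ≤ rearrangement ω F (ENNReal.ofReal t) := by
    refine le_sInf fun s' hs' => ?_
    by_contra! hlt
    rw [ENNReal.ofReal_coe_nnreal] at hs'
    refine (ht.trans_le ?_).not_ge hs'.2
    exact measure_mono fun x hx => lt_trans hlt hx
  have h2 : ENNReal.ofReal t ^ (1 / p) * rearrangement ω F (ENNReal.ofReal t) ≤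
      weakLebesgueNorm ω p F :=
    le_iSup₂_of_le (t : ℝ) (by positivity) le_rfl
  rw [← ENNReal.rpow_inv_le_iff hp, ENNReal.le_div_iff_mul_le (Or.inl hs0)
    (Or.inl ENNReal.ofReal_ne_top)]
  rw [ENNReal.ofReal_coe_nnreal, one_div] at h2
  rw [ENNReal.ofReal_coe_nnreal] at h1
  exact le_trans (by gcongr) h2

/-- **Kolmogorov's inequality**: on a finite measure space weak `L^p` is contained in `L^q` for
`q < p`. -/
lemma lintegral_rpow_le_of_measure_lt_le {α : Type*} [MeasurableSpace α] {μ : Measure α}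
    [IsFiniteMeasure μ] {p q : ℝ} (hq : 0 < q) (hqp : q < p) {G : α → ℝ≥0∞} (hG : Measurable G)
    {A : ℝ≥0∞} (hA : A ≠ ∞)
    (H : ∀ s : ℝ, 0 < s → μ {x | ENNReal.ofReal s < G x} ≤ (A / ENNReal.ofReal s) ^ p) :
    ∫⁻ x, G x ^ q ∂μ ≤ ENNReal.ofReal (p / (p - q)) * A ^ q * μ Set.univ ^ (1 - q / p) := by
  have hp : 0 < p := hq.trans hqp
  have hpq : 0 < p - q := by linarith
  have hcake := lintegral_Ioi_rpow_mul_setLIntegral (μ := μ) (s := q - 1) (by linarith)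
    hG (measurable_const (a := (1 : ℝ≥0∞)))
  simp only [sub_add_cancel, one_mul, lintegral_const, Measure.restrict_apply_univ] at hcake
  have hq0 : ENNReal.ofReal q ≠ 0 := by simpa using hq
  have hcake' : ∫⁻ x, G x ^ q ∂μ = ENNReal.ofReal q * ∫⁻ t in Set.Ioi (0 : ℝ),
      ENNReal.ofReal (t ^ (q - 1)) * μ {x | ENNReal.ofReal t < G x} := by
    rw [hcake, ← mul_assoc, ENNReal.mul_inv_cancel hq0 ENNReal.ofReal_ne_top, one_mul]
  rcases eq_or_ne (μ Set.univ) 0 with hm0 | hm0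
  · rw [Measure.measure_univ_eq_zero.1 hm0]; simp
  rcases eq_or_ne A 0 with hA0 | hA0
  · have : ∫⁻ t in Set.Ioi (0 : ℝ),
        ENNReal.ofReal (t ^ (q - 1)) * μ {x | ENNReal.ofReal t < G x} = 0 := by
      rw [setLIntegral_congr_fun (g := fun _ => 0) measurableSet_Ioi, lintegral_zero]
      intro t ht
      have := H t ht
      rw [hA0, ENNReal.zero_div, ENNReal.zero_rpow_of_pos hp, nonpos_iff_eq_zero] at this
      simp [this]
    rw [hcake', this, mul_zero]
    exact zero_le
  set m := μ Set.univ with hm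
  have hm1 : m ≠ ∞ := measure_ne_top _ _
  -- The level at which the trivial bound `m` and the weak type bound agree.
  set α' := A * m ^ (-(1 / p)) with hα
  have hα0 : α' ≠ 0 := mul_ne_zero hA0 (by simp [hm0, hm1])
  have hα1 : α' ≠ ∞ := ENNReal.mul_ne_top hA (by simp [hm0, hm1])
  set a := α'.toReal with ha
  have ha0 : 0 < a := ENNReal.toReal_pos hα0 hα1
  have haα : ENNReal.ofReal a = α' := ENNReal.ofReal_toReal hα1
  have hpt : ∀ t ∈ Set.Ioi (0 : ℝ),
      ENNReal.ofReal (t ^ (q - 1)) * μ {x | ENNReal.ofReal t < G x} ≤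
      m * {t : ℝ | ENNReal.ofReal t < α'}.indicator (fun t => ENNReal.ofReal (t ^ (q - 1))) t +
      A ^ p * (Set.Ici a).indicator (fun t => ENNReal.ofReal (t ^ (q - p - 1))) t := by
    intro t ht
    have ht0 : (0 : ℝ) < t := ht
    by_cases hta : t < a
    · have h1 : ENNReal.ofReal t < α' := by
        rw [← haα]; exact (ENNReal.ofReal_lt_ofReal_iff ha0).2 hta
      rw [Set.indicator_of_mem (s := {t : ℝ | ENNReal.ofReal t < α'}) (by simpa using h1), mul_comm]
      refine le_trans ?_ le_self_add
      gcongr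
      exact measure_mono (Set.subset_univ _)
    · rw [Set.indicator_of_mem (s := Set.Ici a) (by simpa using hta)]
      refine le_trans ?_ le_add_self
      calc _ ≤ ENNReal.ofReal (t ^ (q - 1)) * (A / ENNReal.ofReal t) ^ p := by
            gcongr
            exact H t ht
        _ = A ^ p * ENNReal.ofReal (t ^ (q - p - 1)) := by
            rw [div_eq_mul_inv, ENNReal.mul_rpow_of_nonneg _ _ hp.le, ENNReal.inv_rpow,
              ← ENNReal.rpow_neg, ENNReal.ofReal_rpow_of_pos ht0, mul_left_comm,
              ← ENNReal.ofReal_mul (by positivity), ← Real.rpow_add ht0]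
            congr 3
            ring
        _ ≤ _ := le_rfl
  have hint : ∫⁻ t in Set.Ioi (0 : ℝ), (Set.Ici a).indicator
      (fun t => ENNReal.ofReal (t ^ (q - p - 1))) t = ENNReal.ofReal (p - q)⁻¹ * α' ^ (q - p) := by
    have hsub : Set.Ici a ∩ Set.Ioi 0 = Set.Ici a :=
      Set.inter_eq_left.2 fun t ht => ha0.trans_le ht
    rw [setLIntegral_indicator measurableSet_Ici, hsub, ← restrict_Ioi_eq_restrict_Ici,
      ← ofReal_integral_eq_lintegral_ofReal
        (integrableOn_Ioi_rpow_of_lt (by linarith) ha0), integral_Ioi_rpow_of_lt (by linarith) ha0,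
      ← haα, ENNReal.ofReal_rpow_of_pos ha0, ← ENNReal.ofReal_mul (by positivity)]
    · congr 1
      have e1 : q - p - 1 + 1 = -(p - q) := by ring
      have e2 : q - p = -(p - q) := by ring
      rw [e1, e2, neg_div_neg_eq, div_eq_inv_mul]
    · filter_upwards [ae_restrict_mem measurableSet_Ioi] with t ht
      exact Real.rpow_nonneg (ha0.trans ht).le _
  have e1 : m * α' ^ q = A ^ q * m ^ (1 - q / p) := by
    rw [hα, ENNReal.mul_rpow_of_nonneg _ _ hq.le, ← ENNReal.rpow_mul, mul_left_comm]
    congr 1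
    nth_rewrite 1 [← ENNReal.rpow_one m]
    rw [← ENNReal.rpow_add _ _ hm0 hm1]
    congr 1
    field_simp
    ring
  have e2 : A ^ p * α' ^ (q - p) = A ^ q * m ^ (1 - q / p) := by
    rw [hα, ENNReal.mul_rpow_of_ne_top hA (by simp [hm0, hm1]), ← ENNReal.rpow_mul, ← mul_assoc,
      ← ENNReal.rpow_add _ _ hA0 hA]
    congr 2
    · ring
    · field_simp; ring
  have hqinv : ENNReal.ofReal q * (ENNReal.ofReal q)⁻¹ = 1 :=
    ENNReal.mul_inv_cancel hq0 ENNReal.ofReal_ne_top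
  rw [hcake']
  calc _ ≤ ENNReal.ofReal q * (m * (α' ^ q / ENNReal.ofReal q) +
        A ^ p * (ENNReal.ofReal (p - q)⁻¹ * α' ^ (q - p))) := by
        gcongr
        refine (setLIntegral_mono' measurableSet_Ioi hpt).trans (le_of_eq ?_)
        rw [lintegral_add_right, lintegral_const_mul' _ _ hm1,
          lintegral_const_mul' _ _ (ENNReal.rpow_ne_top_of_nonneg hp.le hA), hint,
          lintegral_Ioi_indicator_rpow (by linarith), sub_add_cancel]
        refine Measurable.const_mul (Measurable.indicator (by fun_prop) measurableSet_Ici) _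
    _ = (ENNReal.ofReal q * (ENNReal.ofReal q)⁻¹) * (m * α' ^ q) +
        ENNReal.ofReal q * ENNReal.ofReal (p - q)⁻¹ * (A ^ p * α' ^ (q - p)) := by
        rw [div_eq_mul_inv]; ring
    _ = (1 + ENNReal.ofReal q * ENNReal.ofReal (p - q)⁻¹) * (A ^ q * m ^ (1 - q / p)) := by
        rw [hqinv, e1, e2]; ring
    _ = _ := by
        rw [mul_assoc, ← ENNReal.ofReal_mul hq.le, ← ENNReal.ofReal_one,
          ← ENNReal.ofReal_add zero_le_one (by positivity)]
        congr 2
        field_simp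
        ring

lemma setLIntegral_cube_rpow_le {ω : (Fin n → ℝ) → ℝ} (hω : LocallyIntegrable ω volume) {p q : ℝ}
    (hq : 0 < q) (hqp : q < p) {G : (Fin n → ℝ) → ℝ≥0∞} (hG : Measurable G)
    (hA : weakLebesgueNorm ω p G ≠ ∞) (c : Fin n → ℝ) {h : ℝ} (hh : 0 < h) :
    ∫⁻ x in cube c h, G x ^ q ∂(weightMeasure ω) ≤
      ENNReal.ofReal (p / (p - q)) * weakLebesgueNorm ω p G ^ q *
        weightMeasure ω (cube c h) ^ (1 - q / p) := by
  have : IsFiniteMeasure ((weightMeasure ω).restrict (cube c h)) :=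
    ⟨by simpa using (weightMeasure_cube_ne_top hω c hh).lt_top⟩
  have := lintegral_rpow_le_of_measure_lt_le (μ := (weightMeasure ω).restrict (cube c h)) hq hqp hG
    hA fun s hs => (Measure.restrict_le_self _).trans (distribution_le ω (hq.trans hqp) G hs)
  rwa [Measure.restrict_apply_univ] at this

lemma morreyNorm_le_weakLebesgueNorm {ω : (Fin n → ℝ) → ℝ} (hω : LocallyIntegrable ω volume)
    {p q : ℝ} (hq : 0 < q) (hqp : q < p) {G : (Fin n → ℝ) → ℝ≥0∞} (hG : Measurable G)
    (hA : weakLebesgueNorm ω p G ≠ ∞) :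
    morreyNorm ω q (1 - q / p) G ≤
      ENNReal.ofReal (p / (p - q)) ^ (1 / q) * weakLebesgueNorm ω p G := by
  have hp : 0 < p := hq.trans hqp
  have hκ : 0 < 1 - q / p := by rw [sub_pos, div_lt_one hp]; exact hqp
  refine iSup_le fun c => iSup₂_le fun h hh => ?_
  have h1 := setLIntegral_cube_rpow_le hω hq hqp hG hA c hh
  set A := weakLebesgueNorm ω p G
  set m := weightMeasure ω (cube c h) ^ (1 - q / p)
  calc (m⁻¹ * ∫⁻ x in cube c h, G x ^ q ∂(weightMeasure ω)) ^ (1 / q)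
      ≤ (m⁻¹ * (ENNReal.ofReal (p / (p - q)) * A ^ q * m)) ^ (1 / q) := by gcongr
    _ = (ENNReal.ofReal (p / (p - q)) * A ^ q * (m⁻¹ * m)) ^ (1 / q) := by congr 1; ring
    _ ≤ (ENNReal.ofReal (p / (p - q)) * A ^ q * 1) ^ (1 / q) := by
        gcongr
        exact ENNReal.inv_mul_le_one _
    _ = _ := by
        rw [mul_one, ENNReal.mul_rpow_of_nonneg _ _ (by positivity), ← ENNReal.rpow_mul,
          mul_one_div_cancel hq.ne', ENNReal.rpow_one]

lemma locallyLebesgue_of_weakLebesgueNorm_ne_top {ω : (Fin n → ℝ) → ℝ}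
    (hω : LocallyIntegrable ω volume) {p q : ℝ} (hq : 0 < q) (hqp : q < p)
    {G : (Fin n → ℝ) → ℝ≥0∞} (hG : Measurable G) (hA : weakLebesgueNorm ω p G ≠ ∞) :
    LocallyLebesgue ω q G := by
  have hp : 0 < p := hq.trans hqp
  have hκ : 0 < 1 - q / p := by rw [sub_pos, div_lt_one hp]; exact hqp
  refine ⟨hG.aemeasurable, fun K hK => ?_⟩
  obtain ⟨R, hR⟩ := hK.isBounded.subset_ball (0 : Fin n → ℝ)
  have hR' : 0 < max R 1 := by positivity
  have hsub : K ⊆ cube 0 (max R 1) := by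
    rw [cube_eq_ball 0 hR']
    exact hR.trans (Metric.ball_subset_ball (le_max_left _ _))
  refine (lintegral_mono_set hsub).trans_lt
    ((setLIntegral_cube_rpow_le hω hq hqp hG hA 0 hR').trans_lt ?_)
  have h1 := ENNReal.rpow_ne_top_of_nonneg hκ.le (weightMeasure_cube_ne_top hω 0 hR')
  have h2 := ENNReal.rpow_ne_top_of_nonneg hq.le hA
  finiteness

/-- Chebyshev's inequality on each cube. -/
lemma weakMorreyNorm_le_morreyNorm (ω : (Fin n → ℝ) → ℝ) {p q : ℝ} (hq : 0 < q) (hqp : q < p)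
    {G : (Fin n → ℝ) → ℝ≥0∞} (hG : Measurable G) :
    weakMorreyNorm ω p q G ≤ morreyNorm ω q (1 - q / p) G := by
  have hp : 0 < p := hq.trans hqp
  refine iSup_le fun c => iSup₂_le fun h hh => ?_
  refine le_trans ?_ (le_iSup_of_le c (le_iSup₂_of_le h hh le_rfl))
  rw [ENNReal.mul_rpow_of_nonneg _ _ (by positivity), ENNReal.inv_rpow, ← ENNReal.rpow_mul]
  have e : (1 - q / p) * (1 / q) = 1 / q - 1 / p := by field_simp
  rw [e]
  gcongr
  refine iSup₂_le fun l hl => ?_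
  rw [one_div, ENNReal.le_rpow_inv_iff hq, ENNReal.mul_rpow_of_nonneg _ _ hq.le,
    ← ENNReal.rpow_mul, inv_mul_cancel₀ hq.ne', ENNReal.rpow_one]
  refine le_trans ?_ (mul_meas_ge_le_lintegral (hG.pow_const q) (ENNReal.ofReal l ^ q))
  refine mul_le_mul_right ?_ _
  rw [Measure.restrict_apply (measurableSet_le measurable_const (hG.pow_const q))]
  refine measure_mono fun x hx => ⟨?_, hx.1⟩
  exact ENNReal.rpow_le_rpow hx.2.le hq.le

/-! ### Sufficiency of the `A_p` condition -/

/-- A real-valued weight in `A_p` either vanishes almost everywhere or is positive almost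
everywhere. -/
lemma MuckenhouptA.ae_eq_zero_or_isMuckenhoupt {p : ℝ} (hp : 1 < p) {ω : (Fin n → ℝ) → ℝ}
    (hω : AEMeasurable ω volume) (hA : MuckenhouptA p ω) :
    weightMeasure ω = 0 ∨ ∃ (C : ℝ≥0) (w : (Fin n → ℝ) → ℝ≥0∞),
      IsMuckenhoupt p C w ∧ weightMeasure ω = volume.withDensity w := by
  have hp1 : 0 < p - 1 := by linarith
  obtain ⟨C, hC⟩ := hA
  obtain ⟨w, hwm, hww⟩ := hω.ennreal_ofReal
  have hμ : weightMeasure ω = volume.withDensity w := withDensity_congr_ae hww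
  have hS (c : Fin n → ℝ) (h : ℝ) : ∫⁻ x in cube c h, ENNReal.ofReal (ω x) ^ (-(1 / (p - 1))) =
      ∫⁻ x in cube c h, dualWeight p w x := by
    refine lintegral_congr_ae (ae_restrict_of_ae ?_)
    filter_upwards [hww] with x hx
    rw [hx, dualWeight]
  have hW (c : Fin n → ℝ) (h : ℝ) : ∫⁻ x in cube c h, ENNReal.ofReal (ω x) =
      ∫⁻ x in cube c h, w x :=
    lintegral_congr_ae (ae_restrict_of_ae hww)
  have hbound : ∀ (c : Fin n → ℝ) (h : ℝ), 0 < h →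
      (∫⁻ x in cube c h, w x) * (∫⁻ x in cube c h, dualWeight p w x) ^ (p - 1) ≤
        C * volume (cube c h) ^ p := by
    intro c h hh
    have h1 := hC c h hh
    rw [hS, hW] at h1
    have hV0 := volume_cube_ne_zero c hh
    have hV1 := volume_cube_ne_top c hh
    set V := volume (cube c h)
    calc (∫⁻ x in cube c h, w x) * (∫⁻ x in cube c h, dualWeight p w x) ^ (p - 1)
        = (V⁻¹ * V) * (V⁻¹ * V) ^ (p - 1) * ((∫⁻ x in cube c h, w x) *
            (∫⁻ x in cube c h, dualWeight p w x) ^ (p - 1)) := by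
          rw [ENNReal.inv_mul_cancel hV0 hV1, ENNReal.one_rpow, one_mul, one_mul]
      _ = (V⁻¹ * ∫⁻ x in cube c h, w x) * (V⁻¹ * ∫⁻ x in cube c h, dualWeight p w x) ^ (p - 1) *
            (V ^ (1 : ℝ) * V ^ (p - 1)) := by
          rw [ENNReal.mul_rpow_of_nonneg _ _ hp1.le, ENNReal.mul_rpow_of_nonneg _ _ hp1.le,
            ENNReal.rpow_one]
          ring
      _ ≤ C * V ^ p := by
          rw [← ENNReal.rpow_add _ _ hV0 hV1, add_sub_cancel]
          gcongr
  have hwtop : ∀ᵐ x, w x ≠ ∞ := by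
    filter_upwards [hww] with x hx
    rw [← hx]
    exact ENNReal.ofReal_ne_top
  by_cases h0 : ∀ N : ℕ, ∫⁻ x in cube (0 : Fin n → ℝ) (N + 1), w x = 0
  · left
    rw [hμ, withDensity_eq_zero_iff hwm.aemeasurable, Filter.EventuallyEq,
      ← Measure.restrict_univ (μ := volume), ← iUnion_cube 0, ae_restrict_iUnion_iff]
    exact fun N => (lintegral_eq_zero_iff hwm).1 (h0 N)
  · right
    push Not at h0
    obtain ⟨N₀, hN₀⟩ := h0
    refine ⟨C, w, ⟨hwm, ?_, hwtop, hbound⟩, hμ⟩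
    rw [← Measure.restrict_univ (μ := volume), ← iUnion_cube 0, ae_restrict_iUnion_iff]
    intro N
    -- A larger cube on which `w` does not vanish identically.
    have hpos : (0 : ℝ) < max N N₀ + 1 := by positivity
    have hsub : ∀ M : ℕ, (M : ℝ) ≤ max N N₀ →
        cube (0 : Fin n → ℝ) (M + 1) ⊆ cube 0 (max N N₀ + 1) :=
      fun M hM y hy i => (hy i).trans_le (by linarith)
    refine ae_restrict_of_ae_restrict_of_subset (hsub N (by exact_mod_cast le_max_left _ _)) ?_
    have h1 : ∫⁻ x in cube (0 : Fin n → ℝ) (max N N₀ + 1), w x ≠ 0 := fun h =>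
      hN₀ (le_antisymm ((lintegral_mono_set
        (hsub N₀ (by exact_mod_cast le_max_right _ _))).trans_eq h) zero_le)
    have h2 : ∫⁻ x in cube (0 : Fin n → ℝ) (max N N₀ + 1), dualWeight p w x ≠ ∞ := by
      intro htop
      have := hbound 0 _ hpos
      rw [htop, ENNReal.top_rpow_of_pos hp1, ENNReal.mul_top h1, top_le_iff] at this
      exact ENNReal.mul_ne_top ENNReal.coe_ne_top
        (ENNReal.rpow_ne_top_of_nonneg (by linarith) (volume_cube_ne_top 0 hpos)) this
    filter_upwards [ae_lt_top (hwm.pow_const _) h2] with x hx hx0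
    rw [hx0, ENNReal.zero_rpow_of_neg (by simpa using hp1)] at hx
    exact lt_irrefl _ hx

lemma measurable_seqNorm_maximal (r : ℝ) (f : ℕ → (Fin n → ℝ) → ℂ) :
    Measurable (seqNorm r fun k => maximal (f k)) :=
  measurable_seqNorm fun k => measurable_maxFun volume fun x => ‖f k x‖ₑ

lemma MuckenhouptA.maximalBounded_weakLebesgueSpace {p r : ℝ} (hp : 1 < p) (hr : 1 < r)
    {ω : (Fin n → ℝ) → ℝ} (hω : AEMeasurable ω volume) (hA : MuckenhouptA p ω) :
    MaximalBounded r (lebesgueSpace ω p) (weakLebesgueSpace ω p) := by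
  have hp0 : 0 < p := by linarith
  obtain ⟨C, hC⟩ : ∃ C : ℝ≥0, ∀ f : ℕ → (Fin n → ℝ) → ℂ, (∀ k, AEMeasurable (f k) volume) →
      lebesgueNorm ω p (seqNorm r fun k => maximal (f k)) ≤
        C * lebesgueNorm ω p (seqNorm r fun k x => ‖f k x‖ₑ) := by
    rcases hA.ae_eq_zero_or_isMuckenhoupt hp hω with h0 | ⟨C, w, hw, hμ⟩
    · refine ⟨0, fun f _ => ?_⟩
      simp [lebesgueNorm, h0, hp0]
    · obtain ⟨N, hN⟩ := exists_lintegral_seqNorm_maxFun_le n hp hr C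
      refine ⟨N ^ (1 / p), fun f hf => ?_⟩
      choose g hgm hfg using fun k => (hf k).enorm
      have h1 : (fun k => maximal (f k)) = fun k => maxFun volume (g k) :=
        funext fun k => maxFun_congr_ae (hfg k)
      have h2 : seqNorm r (fun k x => ‖f k x‖ₑ) =ᵐ[volume] seqNorm r g := by
        filter_upwards [ae_all_iff.2 hfg] with x hx
        simp only [seqNorm, hx]
      have h3 : ∫⁻ x, seqNorm r (fun k x => ‖f k x‖ₑ) x ^ p ∂(weightMeasure ω) =
          ∫⁻ x, seqNorm r g x ^ p * w x := by
        rw [← lintegral_weight hw.measurable ((measurable_seqNorm hgm).pow_const p), ← hμ]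
        refine lintegral_congr_ae ((weightMeasure_absolutelyContinuous ω).ae_le ?_)
        filter_upwards [h2] with x hx
        rw [hx]
      rw [lebesgueNorm, lebesgueNorm, h3, h1, hμ, lintegral_weight hw.measurable
        ((measurable_seqNorm fun k => measurable_maxFun _ _).pow_const p),
        ENNReal.coe_rpow_of_nonneg _ (by positivity),
        ← ENNReal.mul_rpow_of_nonneg _ _ (by positivity)]
      exact ENNReal.rpow_le_rpow (hN w hw g hgm) (by positivity)
  refine ⟨C, fun f hf hX => ?_⟩
  have h1 := (weakLebesgueNorm_le_lebesgueNorm ω hp0 (measurable_seqNorm_maximal r f)).trans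
    (hC f hf)
  exact ⟨⟨(measurable_seqNorm_maximal r f).aemeasurable,
    h1.trans_lt (ENNReal.mul_lt_top ENNReal.coe_lt_top hX.2)⟩, h1⟩

lemma MaximalBounded.morreySpace_of_weakLebesgueSpace {p q r : ℝ} (hq : 0 < q) (hqp : q < p)
    {ω : (Fin n → ℝ) → ℝ} (hω : LocallyIntegrable ω volume) {X : FunctionSpace n}
    (H : MaximalBounded r X (weakLebesgueSpace ω p)) :
    MaximalBounded r X (morreySpace ω p q) := by
  obtain ⟨C, hC⟩ := H
  have hK : ENNReal.ofReal (p / (p - q)) ^ (1 / q) ≠ ∞ :=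
    ENNReal.rpow_ne_top_of_nonneg (by positivity) ENNReal.ofReal_ne_top
  refine ⟨(ENNReal.ofReal (p / (p - q)) ^ (1 / q)).toNNReal * C, fun f hf hX => ?_⟩
  obtain ⟨⟨-, hfin⟩, hle⟩ := hC f hf hX
  have hG := measurable_seqNorm_maximal r f
  have h1 := morreyNorm_le_weakLebesgueNorm hω hq hqp hG hfin.ne
  refine ⟨⟨locallyLebesgue_of_weakLebesgueNorm_ne_top hω hq hqp hG hfin.ne,
    h1.trans_lt (ENNReal.mul_lt_top hK.lt_top hfin)⟩, h1.trans ?_⟩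
  rw [ENNReal.coe_mul, ENNReal.coe_toNNReal hK, mul_assoc]
  gcongr
  exact hle

lemma MaximalBounded.weakMorreySpace_of_morreySpace {p q r : ℝ} (hq : 0 < q) (hqp : q < p)
    {ω : (Fin n → ℝ) → ℝ} {X : FunctionSpace n} (H : MaximalBounded r X (morreySpace ω p q)) :
    MaximalBounded r X (weakMorreySpace ω p q) := by
  obtain ⟨C, hC⟩ := H
  refine ⟨C, fun f hf hX => ?_⟩
  obtain ⟨⟨hloc, hfin⟩, hle⟩ := hC f hf hX
  have h1 := weakMorreyNorm_le_morreyNorm ω hq hqp (measurable_seqNorm_maximal r f)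
  exact ⟨⟨hloc, h1.trans_lt hfin⟩, h1.trans hle⟩

/-! ### Necessity of the `A_p` condition -/

/-- Boundedness into the weak Morrey space, tested on the cube that carries a single function. -/
lemma MaximalBounded.exists_average_mul_le {p q r : ℝ} (hq : 0 < q) (hqp : q < p) (hr : 0 < r)
    {ω : (Fin n → ℝ) → ℝ} (hω : LocallyIntegrable ω volume)
    (H : MaximalBounded r (lebesgueSpace ω p) (weakMorreySpace ω p q)) :
    ∃ C : ℝ≥0, ∀ f : (Fin n → ℝ) → ℂ, AEMeasurable f volume →
      lebesgueNorm ω p (fun x => ‖f x‖ₑ) < ∞ → ∀ (c : Fin n → ℝ) (h : ℝ), 0 < h →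
        ((volume (cube c h))⁻¹ * ∫⁻ y in cube c h, ‖f y‖ₑ) * weightMeasure ω (cube c h) ^ (1 / p) ≤
          C * lebesgueNorm ω p (fun x => ‖f x‖ₑ) := by
  have hp : 0 < p := hq.trans hqp
  obtain ⟨C, hC⟩ := H
  refine ⟨C, fun f hf hfin c h hh => ?_⟩
  let F : ℕ → (Fin n → ℝ) → ℂ := fun k => if k = 0 then f else 0
  have hF1 : seqNorm r (fun k x => ‖F k x‖ₑ) = fun x => ‖f x‖ₑ := by
    ext x
    rw [seqNorm, tsum_eq_single 0 (fun k hk => by simp [F, hk, hr]), ← ENNReal.rpow_mul,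
      mul_one_div_cancel hr.ne', ENNReal.rpow_one]
    simp [F]
  have hmax0 (x : Fin n → ℝ) : maximal (0 : (Fin n → ℝ) → ℂ) x = 0 := by
    simp [maximal]
  have hF2 : seqNorm r (fun k => maximal (F k)) = maximal f := by
    ext x
    rw [seqNorm, tsum_eq_single 0 (fun k hk => by simp [F, hk, hr, hmax0]), ← ENNReal.rpow_mul,
      mul_one_div_cancel hr.ne', ENNReal.rpow_one]
    simp [F]
  have hb := (hC F (fun k => by by_cases hk : k = 0 <;> simp [F, hk, hf]; exact aemeasurable_const)
    (by rw [hF1]; exact ⟨hf.enorm, hfin⟩)).2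
  rw [hF1, hF2] at hb
  refine le_trans ?_ hb
  set m := weightMeasure ω (cube c h) with hm
  rcases eq_or_ne m 0 with hm0 | hm0
  · rw [hm0, ENNReal.zero_rpow_of_pos (by positivity), mul_zero]
    exact zero_le
  have hm1 : m ≠ ∞ := weightMeasure_cube_ne_top hω c hh
  have hmp0 : m ^ (1 / p) ≠ 0 := by simp [hm0, hm1]
  have hmp1 : m ^ (1 / p) ≠ ∞ := ENNReal.rpow_ne_top_of_nonneg (by positivity) hm1
  rw [← ENNReal.le_div_iff_mul_le (Or.inl hmp0) (Or.inl hmp1)]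
  refine ENNReal.le_of_forall_nnreal_lt fun l hl => ?_
  rw [ENNReal.le_div_iff_mul_le (Or.inl hmp0) (Or.inl hmp1)]
  rcases eq_or_ne l 0 with rfl | hl0
  · simp
  refine le_iSup_of_le c (le_iSup₂_of_le h hh ?_)
  have hset : {x | x ∈ cube c h ∧ ENNReal.ofReal (l : ℝ) < maximal f x} = cube c h := by
    ext x
    refine ⟨fun hx => hx.1, fun hx => ⟨hx, ?_⟩⟩
    rw [ENNReal.ofReal_coe_nnreal]
    exact hl.trans_le (average_le_maxFun volume (fun y => ‖f y‖ₑ) hh hx)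
  calc (l : ℝ≥0∞) * m ^ (1 / p) = (m ^ (1 / q - 1 / p))⁻¹ * (l * m ^ (1 / q)) := by
        rw [← ENNReal.rpow_neg, mul_left_comm, ← ENNReal.rpow_add _ _ hm0 hm1]
        congr 2
        ring
    _ ≤ _ := by
        gcongr
        refine le_iSup₂_of_le (l : ℝ) (by positivity) ?_
        rw [hset, ENNReal.ofReal_coe_nnreal]

/-- The test functions `(ω + ε) ^ (-1 / (p - 1))` on a cube give the `A_p` condition in the limit
`ε → 0`; the summand `ε` ensures that they belong to `L^p_ω`. -/
lemma MaximalBounded.muckenhouptA {p q r : ℝ} (hp : 1 < p) (hq : 0 < q) (hqp : q < p) (hr : 0 < r)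
    {ω : (Fin n → ℝ) → ℝ} (hω0 : ∀ x, 0 ≤ ω x) (hω : LocallyIntegrable ω volume)
    (H : MaximalBounded r (lebesgueSpace ω p) (weakMorreySpace ω p q)) : MuckenhouptA p ω := by
  have hp0 : 0 < p := by linarith
  have hp1 : 0 < p - 1 := by linarith
  have hωm : AEMeasurable ω volume := hω.aestronglyMeasurable.aemeasurable
  obtain ⟨C, hC⟩ := H.exists_average_mul_le hq hqp hr hω
  refine ⟨C ^ p, fun c h hh => ?_⟩
  have hV0 := volume_cube_ne_zero c hh
  have hV1 := volume_cube_ne_top c hh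
  have hm1 := weightMeasure_cube_ne_top hω c hh
  rw [← withDensity_cube, ← weightMeasure]
  set V := volume (cube c h) with hV
  set m := weightMeasure ω (cube c h) with hm
  set s := 1 / (p - 1) with hs
  have hs0 : 0 < s := by positivity
  -- The bound for the regularised weights.
  have key : ∀ ε : ℝ, 0 < ε → m * (∫⁻ x in cube c h, ENNReal.ofReal (ω x + ε) ^ (-s)) ^ (p - 1) ≤
      C ^ p * V ^ p := by
    intro ε hε
    have hpos : ∀ x, 0 < ω x + ε := fun x => by have := hω0 x; linarith
    set f : (Fin n → ℝ) → ℂ := (cube c h).indicator fun x => (((ω x + ε) ^ (-s) : ℝ) : ℂ) with hf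
    have hfm : AEMeasurable f volume := by
      refine AEMeasurable.indicator ?_ (measurableSet_cube c h)
      exact Complex.measurable_ofReal.comp_aemeasurable ((hωm.add_const ε).pow_const _)
    have hfe : ∀ x, ‖f x‖ₑ = (cube c h).indicator (fun x => ENNReal.ofReal (ω x + ε) ^ (-s)) x := by
      intro x
      rw [hf, enorm_indicator_eq_indicator_enorm]
      congr 1
      ext y
      rw [← ofReal_norm, Complex.norm_real, Real.norm_of_nonneg
        (Real.rpow_nonneg (hpos y).le _), ENNReal.ofReal_rpow_of_pos (hpos y)]
    set A := ∫⁻ x in cube c h, ENNReal.ofReal (ω x + ε) ^ (-s) with hA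
    have hA1 : A ≠ ∞ := by
      refine ne_top_of_le_ne_top (b := ENNReal.ofReal ε ^ (-s) * V) ?_ ?_
      · exact ENNReal.mul_ne_top (by simp [hε]) hV1
      · rw [← setLIntegral_const]
        refine lintegral_mono fun x => ?_
        rw [ENNReal.rpow_neg, ENNReal.rpow_neg]
        gcongr
        linarith [hω0 x]
    have hA0 : A ≠ 0 := by
      intro h0
      rw [hA, lintegral_eq_zero_iff' ((hωm.add_const ε).ennreal_ofReal.pow_const _).restrict] at h0
      have : ∀ᵐ x ∂(volume.restrict (cube c h)), False := by
        filter_upwards [h0] with x hx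
        simp [hs0, not_lt.2 hs0.le] at hx
      rw [ae_iff] at this
      simp [hV0, ← hV] at this
    have hav : ∫⁻ y in cube c h, ‖f y‖ₑ = A := by
      refine setLIntegral_congr_fun (measurableSet_cube c h) fun x hx => ?_
      simp only [hfe, Set.indicator_of_mem hx]
    have hnorm : ∫⁻ x, ‖f x‖ₑ ^ p ∂(weightMeasure ω) ≤ A := by
      rw [weightMeasure, lintegral_withDensity_eq_lintegral_mul₀ hωm.ennreal_ofReal
        (hfm.enorm.pow_const p), hA, ← lintegral_indicator (measurableSet_cube c h)]
      refine lintegral_mono fun x => ?_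
      rw [Pi.mul_apply, hfe]
      by_cases hx : x ∈ cube c h
      · rw [Set.indicator_of_mem hx]
        have h0 : ENNReal.ofReal (ω x + ε) ≠ 0 := by simpa using hpos x
        calc ENNReal.ofReal (ω x) * (ENNReal.ofReal (ω x + ε) ^ (-s)) ^ p
            ≤ ENNReal.ofReal (ω x + ε) ^ (1 : ℝ) * (ENNReal.ofReal (ω x + ε) ^ (-s)) ^ p := by
              rw [ENNReal.rpow_one]
              gcongr
              linarith
          _ = ENNReal.ofReal (ω x + ε) ^ (-s) := by
              rw [← ENNReal.rpow_mul, ← ENNReal.rpow_add _ _ h0 ENNReal.ofReal_ne_top]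
              congr 1
              rw [hs]; field_simp; ring
      · rw [Set.indicator_of_notMem hx, ENNReal.zero_rpow_of_pos hp0,
          mul_zero]
    have hnorm' : lebesgueNorm ω p (fun x => ‖f x‖ₑ) ≤ A ^ (1 / p) :=
      ENNReal.rpow_le_rpow hnorm (by positivity)
    have h1 := hC f hfm (hnorm'.trans_lt
      (ENNReal.rpow_ne_top_of_nonneg (by positivity) hA1).lt_top) c h hh
    rw [hav] at h1
    have h2 := ENNReal.rpow_le_rpow (h1.trans (mul_le_mul_right hnorm' _)) hp0.le
    rw [ENNReal.mul_rpow_of_nonneg _ _ hp0.le, ENNReal.mul_rpow_of_nonneg _ _ hp0.le,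
      ENNReal.mul_rpow_of_nonneg _ _ hp0.le, ENNReal.inv_rpow, ← ENNReal.rpow_mul,
      ← ENNReal.rpow_mul, one_div_mul_cancel hp0.ne', ENNReal.rpow_one, ENNReal.rpow_one] at h2
    have hVp0 : V ^ p ≠ 0 := by simp [hV0, hV1]
    have hVp1 : V ^ p ≠ ∞ := ENNReal.rpow_ne_top_of_nonneg hp0.le hV1
    rw [← ENNReal.mul_le_mul_iff_left hA0 hA1]
    have eA : A ^ p = A ^ (p - 1) * A := by
      nth_rewrite 3 [← ENNReal.rpow_one A]
      rw [← ENNReal.rpow_add _ _ hA0 hA1, sub_add_cancel]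
    calc m * A ^ (p - 1) * A = (V ^ p * (V ^ p)⁻¹) * (A ^ p * m) := by
          rw [ENNReal.mul_inv_cancel hVp0 hVp1, eA]; ring
      _ = V ^ p * ((V ^ p)⁻¹ * A ^ p * m) := by ring
      _ ≤ V ^ p * (C ^ p * A) := by gcongr
      _ = _ := by ring
  -- The limit `ε → 0`.
  have hlim : m * (∫⁻ x in cube c h, ENNReal.ofReal (ω x) ^ (-s)) ^ (p - 1) ≤ C ^ p * V ^ p := by
    rcases eq_or_ne m 0 with hm0 | hm0
    · rw [hm0, zero_mul]; exact zero_le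
    have ht : Filter.Tendsto (fun k : ℕ => ∫⁻ x in cube c h,
        ENNReal.ofReal (ω x + 1 / ((k : ℝ) + 1)) ^ (-s)) Filter.atTop
        (nhds (∫⁻ x in cube c h, ENNReal.ofReal (ω x) ^ (-s))) := by
      refine lintegral_tendsto_of_tendsto_of_monotone
        (fun k => ((hωm.add_const _).ennreal_ofReal.pow_const _).restrict)
        (Filter.Eventually.of_forall fun x k l hkl => ?_) (Filter.Eventually.of_forall fun x => ?_)
      · simp only [ENNReal.rpow_neg]
        gcongr
      · have h1 : Filter.Tendsto (fun k : ℕ => ω x + 1 / ((k : ℝ) + 1)) Filter.atTop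
            (nhds (ω x + 0)) := tendsto_const_nhds.add tendsto_one_div_add_atTop_nhds_zero_nat
        rw [add_zero] at h1
        exact (ENNReal.continuous_rpow_const.tendsto _).comp
          ((ENNReal.continuous_ofReal.tendsto _).comp h1)
    have ht' := ENNReal.Tendsto.const_mul (a := m)
      ((ENNReal.continuous_rpow_const (y := p - 1)).tendsto _ |>.comp ht) (Or.inr hm1)
    exact le_of_tendsto' ht' fun k => key _ (by positivity)
  have hVp0 : V ^ p ≠ 0 := by simp [hV0, hV1]
  have hVp1 : V ^ p ≠ ∞ := ENNReal.rpow_ne_top_of_nonneg hp0.le hV1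
  rw [← ENNReal.mul_le_mul_iff_left hVp0 hVp1, ENNReal.coe_rpow_of_nonneg _ hp0.le]
  refine le_trans (le_of_eq ?_) hlim
  have eV : V ^ p = V ^ (p - 1) * V := by
    nth_rewrite 3 [← ENNReal.rpow_one V]
    rw [← ENNReal.rpow_add _ _ hV0 hV1, sub_add_cancel]
  set S := ∫⁻ x in cube c h, ENNReal.ofReal (ω x) ^ (-s)
  calc V⁻¹ * m * (V⁻¹ * S) ^ (p - 1) * V ^ p
      = (V⁻¹ * V) * (V⁻¹ * V) ^ (p - 1) * (m * S ^ (p - 1)) := by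
        rw [eV, ENNReal.mul_rpow_of_nonneg _ _ hp1.le, ENNReal.mul_rpow_of_nonneg _ _ hp1.le]
        ring
    _ = _ := by rw [ENNReal.inv_mul_cancel hV0 hV1, ENNReal.one_rpow, one_mul, one_mul]

end WeightedMaximal

end

theorem mainTheorem3 (n : ℕ) (hn : 1 ≤ n) (p q r : ℝ) (hq : 1 < q) (hqp : q < p) (hr : 1 < r)
    (ω : (Fin n → ℝ) → ℝ) (hω0 : ∀ x, 0 ≤ ω x) (hω : LocallyIntegrable ω volume) :
    List.TFAE
      [WeightedMaximal.MuckenhouptA p ω,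
       WeightedMaximal.MaximalBounded r (WeightedMaximal.lebesgueSpace ω p)
         (WeightedMaximal.weakLebesgueSpace ω p),
       WeightedMaximal.MaximalBounded r (WeightedMaximal.lebesgueSpace ω p)
         (WeightedMaximal.morreySpace ω p q),
       WeightedMaximal.MaximalBounded r (WeightedMaximal.lebesgueSpace ω p)
         (WeightedMaximal.weakMorreySpace ω p q)] := by
  have hq0 : 0 < q := by linarith
  have hp : 1 < p := by linarith
  tfae_have 1 → 2 := fun H =>
    H.maximalBounded_weakLebesgueSpace hp hr hω.aestronglyMeasurable.aemeasurable
  tfae_have 2 → 3 := fun H => H.morreySpace_of_weakLebesgueSpace hq0 hqp hω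
  tfae_have 3 → 4 := fun H => H.weakMorreySpace_of_morreySpace hq0 hqp
  tfae_have 4 → 1 := fun H => H.muckenhouptA hp hq0 hqp (by linarith) hω0 hω
  tfae_finish
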